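/- Let $(\mathcal A,\varphi)$ be a non-commutative probability space ($\mathcal A$ a unital complex algebra, $\varphi:\mathcal A\to\mathbb C$ linear with $\varphi(1)=1$) with $\varphi(xy)=\varphi(yx)$ for all $x,y\in\mathcal A$. Let $n\ge 1$, and let $s$, $\{b_1,\dots,b_n\}$ and $\{d_0,d_1,\dots,d_n\}$ be free in $(\mathcal A,\varphi)$, i.e. all mixed free cumulants of elements of these three families vanish. Let $s$ be standard semicircular: $\varphi(s^k)=\frac{k!}{(k/2)!\,(k/2+1)!}$ for even $k$ and $\varphi(s^k)=0$ for odd $k$. Write $NC(m)$ for the set of non-crossing partitions of $\{1,\dots,m\}$ and $NC_2(m)$ for the set of those all of whose blocks have two elements. For $\pi\in NC(m)$ let $\varphi_\pi[a_1,\dots,a_m]=\prod_{V\in\pi}\varphi(a_{i_1}a_{i_2}\cdots a_{i_r})$, where $V=\{i_1<\cdots<i_r\}$, and let $K(\pi)\in NC(m)$ be the Kreweras complement, i.e. the largest non-crossing partition $\sigma$ of $\{\bar1,\dots,\bar m\}\cong\{1,\dots,m\}$ for which $\pi\cup\sigma$ is non-crossing on $1<\bar1<2<\bar2<\cdots<m<\bar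 m$. (a) $$\varphi(d_0sb_1sd_1sb_2sd_2\cdots sb_nsd_n)=\sum_{\pi\in NC_2(2n)}\varphi_{K(\pi)}[b_1,d_1,b_2,d_2,\dots,b_n,d_nd_0]$$ $$=\sum_{\pi\in NC(n)}\varphi_\pi[b_1,b_2,\dots,b_n]\,\varphi_{K(\pi)}[d_1,\dots,d_{n-1},d_nd_0]$$ $$=\sum_{\pi\in NC(n)}\varphi_\pi[d_1,\dots,d_{n-1},d_nd_0]\,\varphi_{K(\pi)}[b_2,\dots,b_n,b_1].$$ (b) Let $t\ge 0$ and $1=k_0<k_1<\cdots<k_t\le n$, and let $\mathcal S$ be the set of all $\pi\in NC_2(2n)$ such that $\{2k_i,2k_{i+1}-1\}\in\pi$ for $0\le i<t$ and $\{2k_t,2k_0-1\}=\{2k_t,1\}\in\pi$. Then $$\sum_{\pi\in\mathcal S}\varphi_{K(\pi)}[b_1,d_1,\dots,b_n,d_nd_0]=\varphi(b_{k_0}b_{k_1}\cdots b_{k_t})\prod_{i=1}^{t+1}\varphi\bigl(d_{k_{i-1}}sb_{k_{i-1}+1}sd_{k_{i-1}+1}\cdots sb_{k_i-1}sd_{k_i-1}\bigr),$$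 where in the product on the right $k_{t+1}=n+1$ and the last letter $d_n$ of the factor $i=t+1$ is replaced by $d_nd_0$ (so this factor is $\varphi(d_nd_0)$ if $k_t=n$, and a factor with $k_i=k_{i-1}+1\le n$ is $\varphi(d_{k_{i-1}})$). -/

import Mathlib

open Finset

noncomputable section

namespace FreeMoments

/-- Partitions of `{1, …, n}`; the label `i` is the element `i - 1` of `Fin n`. -/
abbrev Part (n : ℕ) := Finpartition (Finset.univ : Finset (Fin n))

/-- `π` is non-crossing: there are no `i < j < k < l` with `i, k` in one block and `j, l` in another. -/
def IsNonCrossing {n : ℕ} (π : Part n) : Prop :=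
  ∀ V ∈ π.parts, ∀ W ∈ π.parts, ∀ i j k l : Fin n,
    i < j → j < k → k < l → i ∈ V → k ∈ V → j ∈ W → l ∈ W → V = W

open Classical in
/-- `NC(n)`. -/
def NC (n : ℕ) : Finset (Part n) := {π | IsNonCrossing π}

open Classical in
/-- `NC₂(m)`: the non-crossing partitions of `{1, …, m}` all of whose blocks have two elements. -/
def NC₂ (m : ℕ) : Finset (Part m) := {π ∈ NC m | ∀ V ∈ π.parts, V.card = 2}

/-- Put `1, 1', 2, 2', …, n, n'` on a line. The points `i'` and `j'` are related when no block of `π`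
has points on both sides of the chord from `i'` to `j'`; the point `x` lies under this chord
exactly when one, and only one, of `x ≤ i`, `x ≤ j` holds. -/
def krewerasSetoid {n : ℕ} (π : Part n) : Setoid (Fin n) where
  r i j := ∀ V ∈ π.parts, ∀ x ∈ V, ∀ y ∈ V, ((x ≤ i ↔ x ≤ j) ↔ (y ≤ i ↔ y ≤ j))
  iseqv :=
    { refl := fun _ _ _ _ _ _ _ => by simp
      symm := fun h V hV x hx y hy => by
        have := h V hV x hx y hy
        tauto
      trans := fun h h' V hV x hx y hy => by
        have := h V hV x hx y hy
        have := h' V hV x hx y hy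
        tauto }

open Classical in
/-- The Kreweras complement `K(π)`; see `kreweras_isGreatest`. -/
def kreweras {n : ℕ} (π : Part n) : Part n := Finpartition.ofSetoid (krewerasSetoid π)

/-- For `π` on `1, …, n` and `σ` on `1', …, n'`, no block of `π` crosses a block of `σ` when the
points are ordered as `1 < 1' < 2 < 2' < ⋯ < n < n'`. -/
def NoMutualCrossing {n : ℕ} (π σ : Part n) : Prop :=
  ∀ V ∈ π.parts, ∀ W ∈ σ.parts, ∀ x ∈ V, ∀ y ∈ V, ∀ i ∈ W, ∀ j ∈ W,
    ¬ (x ≤ i ∧ i < y ∧ y ≤ j) ∧ ¬ (i < x ∧ x ≤ j ∧ j < y)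

/-- `K(π)` is the largest non-crossing partition `σ` of `1', …, n'` such that `π ∪ σ` is a non-crossing
partition of `1, 1', …, n, n'`. -/
theorem kreweras_isGreatest {n : ℕ} (π : Part n) :
    IsGreatest {σ : Part n | IsNonCrossing σ ∧ NoMutualCrossing π σ} (kreweras π) := by
  classical
  have key : ∀ W ∈ (kreweras π).parts, ∀ i ∈ W, ∀ j, j ∈ W ↔ (krewerasSetoid π).r i j := by
    intro W hW i hi j
    have h1 : W = (kreweras π).part i := ((kreweras π).part_eq_of_mem hW hi).symm
    rw [h1]
    exact Finpartition.mem_part_ofSetoid_iff_rel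
  refine ⟨⟨?_, ?_⟩, ?_⟩
  · intro V hV W hW i j k l hij hjk hkl hi hk hj hl
    have hik := (key V hV i hi k).1 hk
    have hjl := (key W hW j hj l).1 hl
    refine (kreweras π).eq_of_mem_parts hV hW hk ((key W hW j hj k).2 ?_)
    intro U hU x hx y hy
    have h1 := hik U hU x hx y hy
    have h2 := hjl U hU x hx y hy
    grind
  · intro V hV W hW x hx y hy i hi j hj
    have h := (key W hW i hi j).1 hj V hV x hx y hy
    grind
  · rintro σ ⟨-, hσ⟩ W hW
    obtain ⟨i, hi⟩ := σ.nonempty_of_mem_parts hW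
    refine ⟨(kreweras π).part i, (kreweras π).part_mem.2 (Finset.mem_univ i), ?_⟩
    intro j hj
    refine (key _ ((kreweras π).part_mem.2 (Finset.mem_univ i)) i
      ((kreweras π).mem_part (Finset.mem_univ i)) j).2 ?_
    intro V hV x hx y hy
    have h1 := hσ V hV W hW x hx y hy i hi j hj
    have h2 := hσ V hV W hW x hx y hy j hj i hi
    have h3 := hσ V hV W hW y hy x hx i hi j hj
    have h4 := hσ V hV W hW y hy x hx j hj i hi
    grind

variable {A : Type*} [Ring A] [Algebra ℂ A]

/-- `φ(a₁ a₂ ⋯ aₙ)`. -/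
def moment (φ : A →ₗ[ℂ] ℂ) {n : ℕ} (a : Fin n → A) : ℂ := φ (List.ofFn a).prod

/-- The tuple `(a_{i₁}, …, a_{iᵣ})` for `V = {i₁ < ⋯ < iᵣ}`. -/
def restrict {n : ℕ} (a : Fin n → A) (V : Finset (Fin n)) : Fin V.card → A :=
  fun i => a (V.orderEmbOfFin rfl i)

/-- `φ_π[a₁, …, aₙ]`, the product over the blocks `V = {i₁ < ⋯ < iᵣ}` of `φ(a_{i₁} ⋯ a_{iᵣ})`. -/
def partMoment (φ : A →ₗ[ℂ] ℂ) {n : ℕ} (π : Part n) (a : Fin n → A) : ℂ :=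
  ∏ V ∈ π.parts, moment φ (restrict a V)

theorem card_lt_of_mem_parts {n : ℕ} {π : Part n} (hπ : π ≠ ⊤) {V : Finset (Fin n)}
    (hV : V ∈ π.parts) : V.card < n := by
  by_contra h
  have hu : V = Finset.univ := Finset.eq_univ_of_card V (by
    have := Finset.card_le_univ V
    simp only [Fintype.card_fin] at this ⊢
    omega)
  subst hu
  refine hπ (top_le_iff.1 ?_)
  intro W hW
  exact ⟨Finset.univ, hV, Finset.subset_univ _⟩

open Classical in
/-- The free cumulants, obtained from the moments by solving the moment-cumulant relation
`φ(a₁ ⋯ aₙ) = ∑_{π ∈ NC(n)} ∏_{V ∈ π} κ[a|V]` for the term of the one-block partition. -/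
def freeCumulant (φ : A →ₗ[ℂ] ℂ) (n : ℕ) (a : Fin n → A) : ℂ :=
  moment φ a - ∑ π : {π : Part n // π ∈ NC n ∧ π ≠ ⊤}, ∏ V : {V // V ∈ π.1.parts},
    freeCumulant φ V.1.card (restrict a V.1)
termination_by n
decreasing_by exact card_lt_of_mem_parts π.2.2 V.2

/-- The sets `S i` of variables are free: every mixed free cumulant of their elements vanishes. -/
def AreFree (φ : A →ₗ[ℂ] ℂ) {ι : Type*} (S : ι → Set A) : Prop :=
  ∀ (m : ℕ) (a : Fin m → A) (c : Fin m → ι),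
    (∀ i, a i ∈ S (c i)) → (∃ i j, c i ≠ c j) → freeCumulant φ m a = 0

/-- `s` is a standard semicircular variable, by its moments. -/
def IsSemicircular (φ : A →ₗ[ℂ] ℂ) (s : A) : Prop :=
  ∀ k : ℕ, φ (s ^ k) =
    if Even k then (k.factorial : ℂ) / ((k / 2).factorial * (k / 2 + 1).factorial) else 0

/-- `d_k s b_{k+1} s d_{k+1} s b_{k+2} s d_{k+2} ⋯ s b_l s d_l` for `k ≤ l` (it is `d_k` for `k = l`). -/
def word (s : A) (b d : ℕ → A) (k l : ℕ) : A :=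
  d k * ((List.range' (k + 1) (l - k)).map fun i => s * b i * s * d i).prod

/-- The family `d₁, …, d_{n-1}, dₙ d₀`. -/
def closeUp (n : ℕ) (d : ℕ → A) : ℕ → A := Function.update d n (d n * d 0)

/-- The tuple `(x₁, …, xₙ)`. -/
def tuple (n : ℕ) (x : ℕ → A) : Fin n → A := fun i => x (i + 1)

/-- The tuple `(x₂, …, xₙ, x₁)`. -/
def rotTuple (n : ℕ) (x : ℕ → A) : Fin n → A := fun i => x ((i + 1) % n + 1)

/-- The tuple `(x₁, y₁, x₂, y₂, …, xₙ, yₙ)`. -/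
def altTuple (n : ℕ) (x y : ℕ → A) : Fin (2 * n) → A :=
  fun i => if (i : ℕ) % 2 = 0 then x (i / 2 + 1) else y (i / 2 + 1)

/-- `{p, q} ∈ π`, for labels `p, q ∈ {1, …, m}`. -/
def HasPair {m : ℕ} (π : Part m) (p q : ℕ) : Prop :=
  ∃ V ∈ π.parts, V.image (fun x : Fin m => (x : ℕ) + 1) = {p, q}

open Classical in
/-- The `π ∈ NC₂(2n)` with `{2kᵢ, 2kᵢ₊₁ - 1} ∈ π` for `0 ≤ i ≤ t`, where `k_{t+1} = k₀`. -/
def chainPairings (n t : ℕ) (k : ℕ → ℕ) : Finset (Part (2 * n)) :=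
  {π ∈ NC₂ (2 * n) |
    (∀ i < t, HasPair π (2 * k i) (2 * k (i + 1) - 1)) ∧ HasPair π (2 * k t) (2 * k 0 - 1)}

end FreeMoments

end

/-! Both sides obey one recursion. On the analytic side, freeness and the vanishing of all cumulants
of `s` except the second give φ(s w) = ∑ φ(w₁) φ(w₂), summed over w = w₁ s w₂, for words w in `s`
and the other letters (`semicircularOver_closure`). With traciality, a word with an odd number of
letters `s` has moment zero (`SemicircularOver.eq_zero_of_odd`). In the word B s d_p s b_{p+1} s ⋯ s
d_l s the first s can therefore be paired only with an s that directly follows some d_{k-1}. This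
splits off φ(d_p s ⋯ s d_{k-1}) and leaves a word of the same shape that begins with B b_k, or just
B if the last s was taken. Iterating collects the letters b over a set V with least element p
(`SemicircularOver.word_expansion`).

On the combinatorial side, let V be the block of the first point p. All other blocks lie in the gaps
of V and the Kreweras complement splits accordingly, so the sum over the partitions with block V
factors over the gaps (`ncSumBlock_insert`). In a single gap p is a singleton, and the slot after p
is merged with the last slot: p can be deleted if d_{q-1} is replaced by d_{q-1} d_p
(`ncSumBlock_singleton`). This matches a rotation under the trace, so induction on the length
identifies each gap with the moment of an alternating word (`ncSumBlock_eq_word`) and the whole sum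
with the moment of the closed word (`ncSum_eq_word`).

This is the second formula of (a). The third is the same formula for the same cyclic word with the
roles of b and d exchanged. The first follows from the bijection `fatten` of NC(n) with NC₂(2n),
under which the complement of the pairing consists of a copy of P on the even slots and a copy of
K(P) on the odd ones (`sum_pairings`, `prod_kr_fatten`). In (b) the prescribed pairs say that {k₀,
…, k_t} is a block (`chain_mem_iff`), and the product is the factorization over its gaps
(`ncSumBlock_chain`). -/

open Finset

noncomputable section

namespace FreeMoments

/-! ### Non-crossing partitions of intervals: cutting and gluing at a block. -/

section

/-- `P` is a non-crossing partition of the set `s` of natural numbers. -/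
structure IsNCPart (s : Finset ℕ) (P : Finset (Finset ℕ)) : Prop where
  nonempty : ∀ U ∈ P, U.Nonempty
  subset : ∀ U ∈ P, U ⊆ s
  cover : ∀ x ∈ s, ∃ U ∈ P, x ∈ U
  eq_of_mem : ∀ U ∈ P, ∀ W ∈ P, ∀ x, x ∈ U → x ∈ W → U = W
  noncross : ∀ U ∈ P, ∀ W ∈ P, ∀ i j k l, i < j → j < k → k < l →
    i ∈ U → k ∈ U → j ∈ W → l ∈ W → U = W

open Classical in
/-- The non-crossing partitions of the interval `[p, q)`. -/
def ncp (p q : ℕ) : Finset (Finset (Finset ℕ)) :=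
  {P ∈ (Ico p q).powerset.powerset | IsNCPart (Ico p q) P}

theorem mem_ncp {p q : ℕ} {P : Finset (Finset ℕ)} : P ∈ ncp p q ↔ IsNCPart (Ico p q) P := by
  simp only [ncp, mem_filter, mem_powerset, and_iff_right_iff_imp]
  intro h U hU
  exact mem_powerset.2 (h.subset U hU)

/-- No block of `P` has points on both sides of the chord joining the slots after `i` and `j`. -/
def SlotRel (P : Finset (Finset ℕ)) (i j : ℕ) : Prop :=
  ∀ U ∈ P, ∀ x ∈ U, ∀ y ∈ U, ((x ≤ i ↔ x ≤ j) ↔ (y ≤ i ↔ y ≤ j))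

theorem SlotRel.refl (P : Finset (Finset ℕ)) (i : ℕ) : SlotRel P i i := by
  intro U _ x _ y _; simp

theorem SlotRel.symm {P : Finset (Finset ℕ)} {i j : ℕ} (h : SlotRel P i j) : SlotRel P j i := by
  intro U hU x hx y hy
  have := h U hU x hx y hy
  tauto

theorem SlotRel.trans {P : Finset (Finset ℕ)} {i j k : ℕ} (h : SlotRel P i j)
    (h' : SlotRel P j k) : SlotRel P i k := by
  intro U hU x hx y hy
  have := h U hU x hx y hy
  have := h' U hU x hx y hy
  tauto

open Classical in
/-- The class of the slot after `i` among the slots of `[p, q)`. -/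
def slotClass (p q : ℕ) (P : Finset (Finset ℕ)) (i : ℕ) : Finset ℕ :=
  {j ∈ Ico p q | SlotRel P i j}

theorem mem_slotClass {p q : ℕ} {P : Finset (Finset ℕ)} {i j : ℕ} :
    j ∈ slotClass p q P i ↔ (p ≤ j ∧ j < q) ∧ SlotRel P i j := by
  simp [slotClass]

/-- The Kreweras complement of a partition of `[p, q)`. -/
def kr (p q : ℕ) (P : Finset (Finset ℕ)) : Finset (Finset ℕ) :=
  (Ico p q).image (slotClass p q P)

theorem mem_kr {p q : ℕ} {P : Finset (Finset ℕ)} {W : Finset ℕ} :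
    W ∈ kr p q P ↔ ∃ i, (p ≤ i ∧ i < q) ∧ slotClass p q P i = W := by
  simp [kr]

theorem slotClass_congr {p q : ℕ} {P : Finset (Finset ℕ)} {i j : ℕ} (h : SlotRel P i j) :
    slotClass p q P i = slotClass p q P j := by
  ext k
  simp only [mem_slotClass]
  exact and_congr_right fun _ => ⟨fun h' => h.symm.trans h', fun h' => h.trans h'⟩

/-- The weighted sum over non-crossing partitions of `[p, q)`, with weight `f` on the blocks and
weight `g` on the blocks of the Kreweras complement. -/
def ncSum (f g : Finset ℕ → ℂ) (p q : ℕ) : ℂ :=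
  ∑ P ∈ ncp p q, (∏ U ∈ P, f U) * ∏ W ∈ kr p q P, g W

/-- The part of `ncSum` over the partitions with the block `V`, without the factor `f V`. -/
def ncSumBlock (f g : Finset ℕ → ℂ) (V : Finset ℕ) (p q : ℕ) : ℂ :=
  ∑ P ∈ ncp p q with V ∈ P, (∏ U ∈ P.erase V, f U) * ∏ W ∈ kr p q P, g W

theorem ncSum_eq_sum_block (f g : Finset ℕ → ℂ) {p q : ℕ} (hpq : p < q) :
    ncSum f g p q =
      ∑ V ∈ (Ico p q).powerset with p ∈ V, f V * ncSumBlock f g V p q := by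
  simp only [ncSumBlock, mul_sum]
  rw [sum_sigma', ncSum]
  symm
  refine sum_bij (fun a _ => a.2) ?_ ?_ ?_ ?_
  · rintro ⟨V, P⟩ h
    simp only [mem_sigma, mem_filter] at h
    exact h.2.1
  · rintro ⟨V, P⟩ h ⟨V', P'⟩ h' e
    simp only [mem_sigma, mem_filter] at h h' e
    subst e
    obtain rfl := (mem_ncp.1 h.2.1).eq_of_mem V h.2.2 V' h'.2.2 p h.1.2 h'.1.2
    rfl
  · intro P hP
    have hP' := mem_ncp.1 hP
    obtain ⟨V, hV, hpV⟩ := hP'.cover p (by simp [hpq])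
    exact ⟨⟨V, P⟩, by simp [hP, hV, hpV, hP'.subset V hV], rfl⟩
  · rintro ⟨V, P⟩ h
    simp only [mem_sigma, mem_filter] at h
    rw [← mul_assoc, mul_prod_erase _ _ h.2.2]

section Split

variable {p k q : ℕ} {V : Finset ℕ}

/-- Glue partitions of `[p, k)` and `[k, q)`, joining `p` to the block `V` of `k`. -/
def glue (p : ℕ) (V : Finset ℕ) (P Q : Finset (Finset ℕ)) : Finset (Finset ℕ) :=
  insert (insert p V) (P.erase {p} ∪ Q.erase V)

/-- Blocks from different sides of `k` cannot cross. A crossing that uses the new point `p` of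
`insert p V` becomes a crossing of `V` in `Q` when `p` is replaced by `k`, the least element of `V`.
-/
theorem glue_isNCPart (hpk : p < k) (hV : V ⊆ Ico k q) (hk : k ∈ V)
    {P Q : Finset (Finset ℕ)} (hP : IsNCPart (Ico p k) P) (hQ : IsNCPart (Ico k q) Q)
    (hpP : {p} ∈ P) (hVQ : V ∈ Q) : IsNCPart (Ico p q) (glue p V P Q) := by
  have hVm : ∀ x ∈ V, k ≤ x ∧ x < q := fun x hx => mem_Ico.1 (hV hx)
  have hPm : ∀ U ∈ P, ∀ x ∈ U, p ≤ x ∧ x < k := fun U hU x hx => mem_Ico.1 (hP.subset U hU hx)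
  have hQm : ∀ U ∈ Q, ∀ x ∈ U, k ≤ x ∧ x < q := fun U hU x hx => mem_Ico.1 (hQ.subset U hU hx)
  have hPp : ∀ U ∈ P, U ≠ {p} → p ∉ U := fun U hU hne hpU =>
    hne (hP.eq_of_mem U hU {p} hpP p hpU (by simp))
  have hQV : ∀ U ∈ Q, U ≠ V → ∀ x ∈ U, x ∉ V := fun U hU hne x hx hxV =>
    hne (hQ.eq_of_mem U hU V hVQ x hx hxV)
  have hkq := hVm k hk
  refine ⟨?_, ?_, ?_, ?_, ?_⟩
  · intro U hU
    simp only [glue, mem_insert, mem_union, mem_erase] at hU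
    rcases hU with rfl | ⟨_, h⟩ | ⟨_, h⟩
    · simp
    · exact hP.nonempty U h
    · exact hQ.nonempty U h
  · intro U hU x hx
    simp only [glue, mem_insert, mem_union, mem_erase] at hU
    rw [mem_Ico]
    rcases hU with rfl | ⟨_, h⟩ | ⟨_, h⟩
    · rw [mem_insert] at hx
      rcases hx with rfl | hx
      · omega
      · have := hVm x hx; omega
    · have := hPm U h x hx; omega
    · have := hQm U h x hx; omega
  · intro x hx
    rw [mem_Ico] at hx
    simp only [glue, mem_insert, mem_union, mem_erase]
    by_cases hxk : x < k
    · obtain ⟨U, hU, hxU⟩ := hP.cover x (mem_Ico.2 ⟨hx.1, hxk⟩)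
      by_cases h : U = {p}
      · exact ⟨insert p V, Or.inl rfl, by rw [h, mem_singleton] at hxU; simp [hxU]⟩
      · exact ⟨U, Or.inr (Or.inl ⟨h, hU⟩), hxU⟩
    · obtain ⟨U, hU, hxU⟩ := hQ.cover x (mem_Ico.2 ⟨by omega, hx.2⟩)
      by_cases h : U = V
      · exact ⟨insert p V, Or.inl rfl, by rw [h] at hxU; simp [hxU]⟩
      · exact ⟨U, Or.inr (Or.inr ⟨h, hU⟩), hxU⟩
  · intro U hU W hW x hxU hxW
    simp only [glue, mem_insert, mem_union, mem_erase] at hU hW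
    rcases hU with rfl | ⟨hU', hU⟩ | ⟨hU', hU⟩ <;> rcases hW with rfl | ⟨hW', hW⟩ | ⟨hW', hW⟩
    · rfl
    · grind
    · grind
    · grind
    · exact hP.eq_of_mem U hU W hW x hxU hxW
    · grind
    · grind
    · grind
    · exact hQ.eq_of_mem U hU W hW x hxU hxW
  · intro U hU W hW a b c e hab hbc hce ha hc hb he
    simp only [glue, mem_insert, mem_union, mem_erase] at hU hW
    rcases hU with rfl | ⟨hU', hU⟩ | ⟨hU', hU⟩ <;> rcases hW with rfl | ⟨hW', hW⟩ | ⟨hW', hW⟩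
    · rfl
    · have := hPm W hW b hb
      have := hPm W hW e he
      grind
    · have h1 := hQm W hW b hb
      have h2 := hQV W hW hW' b hb
      have hcV : c ∈ V := by grind
      rw [mem_insert] at ha
      rcases ha with rfl | ha
      · have hne : b ≠ k := fun h => h2 (h ▸ hk)
        exact (hW' (hQ.noncross V hVQ W hW k b c e (by omega) hbc hce hk hcV hb he).symm).elim
      · exact (hW' (hQ.noncross V hVQ W hW a b c e hab hbc hce ha hcV hb he).symm).elim
    · have := hPm U hU a ha
      have := hPm U hU c hc
      grind
    · exact hP.noncross U hU W hW a b c e hab hbc hce ha hc hb he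
    · have := hPm U hU c hc
      have := hQm W hW b hb
      omega
    · have h1 := hQm U hU a ha
      have hbV : b ∈ V := by grind
      have heV : e ∈ V := by grind
      exact (hU' (hQ.noncross U hU V hVQ a b c e hab hbc hce ha hc hbV heV)).elim
    · have := hQm U hU a ha
      have := hPm W hW b hb
      omega
    · exact hQ.noncross U hU W hW a b c e hab hbc hce ha hc hb he

/-- The part of a partition with the block `insert p V` that lives on `[p, k)`. -/
def cutLeft (p k : ℕ) (V : Finset ℕ) (P : Finset (Finset ℕ)) : Finset (Finset ℕ) :=
  insert {p} ((P.erase (insert p V)).filter (· ⊆ Ico p k))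

/-- The part of a partition with the block `insert p V` that lives on `[k, q)`. -/
def cutRight (p k q : ℕ) (V : Finset ℕ) (P : Finset (Finset ℕ)) : Finset (Finset ℕ) :=
  insert V ((P.erase (insert p V)).filter (· ⊆ Ico k q))

/-- A block with a point strictly between `p` and `k` and another beyond `k` would cross the block
that contains `p` and `k`. -/
theorem subset_or_subset_of_block (hk : k ∈ V)
    {P : Finset (Finset ℕ)} (hP : IsNCPart (Ico p q) P) (hVP : insert p V ∈ P)
    {U : Finset ℕ} (hU : U ∈ P) (hne : U ≠ insert p V) :
    U ⊆ Ico p k ∨ U ⊆ Ico k q := by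
  by_contra! h
  obtain ⟨h1, h2⟩ := h
  rw [not_subset] at h1 h2
  obtain ⟨y, hy, hy'⟩ := h1
  obtain ⟨x, hx, hx'⟩ := h2
  have hxm := mem_Ico.1 (hP.subset U hU hx)
  have hym := mem_Ico.1 (hP.subset U hU hy)
  rw [mem_Ico] at hx' hy'
  have hd : ∀ z ∈ U, z ∉ insert p V := fun z hz hz' => hne (hP.eq_of_mem U hU _ hVP z hz hz')
  have hxp : x ≠ p := fun h => hd x hx (by simp [h])
  have hyk : y ≠ k := fun h => hd y hy (by simp [h, hk])
  exact hne (hP.noncross _ hVP U hU p x k y (by omega) (by omega) (by omega) (by simp)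
    (by simp [hk]) hx hy).symm

theorem cutLeft_isNCPart (hpk : p < k) (hV : V ⊆ Ico k q) (hk : k ∈ V)
    {P : Finset (Finset ℕ)} (hP : IsNCPart (Ico p q) P) (hVP : insert p V ∈ P) :
    IsNCPart (Ico p k) (cutLeft p k V P) := by
  have hd : ∀ U ∈ P, U ≠ insert p V → p ∉ U := fun U hU hne hp =>
    hne (hP.eq_of_mem U hU _ hVP p hp (by simp))
  have hmem : ∀ {U}, U ∈ cutLeft p k V P ↔ U = {p} ∨ ((U ≠ insert p V ∧ U ∈ P) ∧ U ⊆ Ico p k) := by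
    intro U; simp [cutLeft]
  refine ⟨?_, ?_, ?_, ?_, ?_⟩
  · intro U hU
    rcases hmem.1 hU with rfl | h
    · simp
    · exact hP.nonempty U h.1.2
  · intro U hU
    rcases hmem.1 hU with rfl | h
    · simp [hpk]
    · exact h.2
  · intro x hx
    rw [mem_Ico] at hx
    have hkq := mem_Ico.1 (hV hk)
    obtain ⟨U, hU, hxU⟩ := hP.cover x (mem_Ico.2 ⟨hx.1, by omega⟩)
    by_cases hUV : U = insert p V
    · have : x = p := by
        rw [hUV, mem_insert] at hxU
        rcases hxU with h | h
        · exact h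
        · have := mem_Ico.1 (hV h); omega
      exact ⟨{p}, hmem.2 (Or.inl rfl), by simp [this]⟩
    · refine ⟨U, hmem.2 (Or.inr ⟨⟨hUV, hU⟩, ?_⟩), hxU⟩
      rcases subset_or_subset_of_block hk hP hVP hU hUV with h | h
      · exact h
      · have := mem_Ico.1 (h hxU); omega
  · intro U hU W hW x hxU hxW
    rcases hmem.1 hU with rfl | hU <;> rcases hmem.1 hW with rfl | hW
    · rfl
    · exact (hd W hW.1.2 hW.1.1 (by rw [← mem_singleton.1 hxU]; exact hxW)).elim
    · exact (hd U hU.1.2 hU.1.1 (by rw [← mem_singleton.1 hxW]; exact hxU)).elim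
    · exact hP.eq_of_mem U hU.1.2 W hW.1.2 x hxU hxW
  · intro U hU W hW a b c e hab hbc hce ha hc hb he
    rcases hmem.1 hU with rfl | hU <;> rcases hmem.1 hW with rfl | hW
    · rfl
    · rw [mem_singleton] at ha hc; omega
    · rw [mem_singleton] at hb he; omega
    · exact hP.noncross U hU.1.2 W hW.1.2 a b c e hab hbc hce ha hc hb he

theorem cutRight_isNCPart (hpk : p < k) (hV : V ⊆ Ico k q) (hk : k ∈ V)
    {P : Finset (Finset ℕ)} (hP : IsNCPart (Ico p q) P) (hVP : insert p V ∈ P) :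
    IsNCPart (Ico k q) (cutRight p k q V P) := by
  have hd : ∀ U ∈ P, U ≠ insert p V → ∀ x ∈ V, x ∉ U := fun U hU hne x hx hxU =>
    hne (hP.eq_of_mem U hU _ hVP x hxU (by simp [hx]))
  have hmem : ∀ {U}, U ∈ cutRight p k q V P ↔
      U = V ∨ ((U ≠ insert p V ∧ U ∈ P) ∧ U ⊆ Ico k q) := by
    intro U; simp [cutRight]
  refine ⟨?_, ?_, ?_, ?_, ?_⟩
  · intro U hU
    rcases hmem.1 hU with rfl | h
    · exact ⟨k, hk⟩
    · exact hP.nonempty U h.1.2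
  · intro U hU
    rcases hmem.1 hU with rfl | h
    · exact hV
    · exact h.2
  · intro x hx
    rw [mem_Ico] at hx
    obtain ⟨U, hU, hxU⟩ := hP.cover x (mem_Ico.2 ⟨by omega, hx.2⟩)
    by_cases hUV : U = insert p V
    · refine ⟨V, hmem.2 (Or.inl rfl), ?_⟩
      rw [hUV, mem_insert] at hxU
      rcases hxU with h | h
      · omega
      · exact h
    · refine ⟨U, hmem.2 (Or.inr ⟨⟨hUV, hU⟩, ?_⟩), hxU⟩
      rcases subset_or_subset_of_block hk hP hVP hU hUV with h | h
      · have := mem_Ico.1 (h hxU); omega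
      · exact h
  · intro U hU W hW x hxU hxW
    rcases hmem.1 hU with rfl | hU <;> rcases hmem.1 hW with rfl | hW
    · rfl
    · exact (hd W hW.1.2 hW.1.1 x hxU hxW).elim
    · exact (hd U hU.1.2 hU.1.1 x hxW hxU).elim
    · exact hP.eq_of_mem U hU.1.2 W hW.1.2 x hxU hxW
  · intro U hU W hW a b c e hab hbc hce ha hc hb he
    rcases hmem.1 hU with rfl | hU <;> rcases hmem.1 hW with rfl | hW
    · rfl
    · exact (hW.1.1 (hP.noncross _ hVP W hW.1.2 a b c e hab hbc hce (by simp [ha])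
        (by simp [hc]) hb he).symm).elim
    · exact (hU.1.1 (hP.noncross U hU.1.2 _ hVP a b c e hab hbc hce ha hc (by simp [hb])
        (by simp [he]))).elim
    · exact hP.noncross U hU.1.2 W hW.1.2 a b c e hab hbc hce ha hc hb he

theorem glue_cut (hk : k ∈ V)
    {P : Finset (Finset ℕ)} (hP : IsNCPart (Ico p q) P) (hVP : insert p V ∈ P) :
    glue p V (cutLeft p k V P) (cutRight p k q V P) = P := by
  have hd : ∀ U ∈ P, U ≠ insert p V → ∀ x ∈ insert p V, x ∉ U := fun U hU hne x hx hxU =>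
    hne (hP.eq_of_mem U hU _ hVP x hxU hx)
  ext U
  simp only [glue, cutLeft, cutRight, mem_insert, mem_union, mem_erase, mem_filter]
  constructor
  · rintro (rfl | ⟨h, rfl | h'⟩ | ⟨h, rfl | h'⟩)
    · exact hVP
    · exact (h rfl).elim
    · exact h'.1.2
    · exact (h rfl).elim
    · exact h'.1.2
  · intro hU
    by_cases hUV : U = insert p V
    · exact Or.inl hUV
    · right
      have hp := hd U hU hUV p (by simp)
      have hk' := hd U hU hUV k (by simp [hk])
      rcases subset_or_subset_of_block hk hP hVP hU hUV with h | h
      · exact Or.inl ⟨fun e => hp (by simp [e]), Or.inr ⟨⟨hUV, hU⟩, h⟩⟩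
      · exact Or.inr ⟨fun e => hk' (by simp [e, hk]), Or.inr ⟨⟨hUV, hU⟩, h⟩⟩

theorem cutLeft_glue {P Q : Finset (Finset ℕ)} (hP : IsNCPart (Ico p k) P)
    (hQ : IsNCPart (Ico k q) Q) (hpP : {p} ∈ P) : cutLeft p k V (glue p V P Q) = P := by
  ext U
  simp only [glue, cutLeft, mem_insert, mem_union, mem_erase, mem_filter]
  constructor
  · rintro (rfl | ⟨⟨h, h' | h' | h'⟩, h''⟩)
    · exact hpP
    · exact (h h').elim
    · exact h'.2
    · obtain ⟨x, hx⟩ := hQ.nonempty U h'.2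
      have := mem_Ico.1 (h'' hx)
      have := mem_Ico.1 (hQ.subset U h'.2 hx)
      omega
  · intro hU
    by_cases h : U = {p}
    · exact Or.inl h
    · refine Or.inr ⟨⟨?_, Or.inr (Or.inl ⟨h, hU⟩)⟩, hP.subset U hU⟩
      rintro rfl
      exact h (hP.eq_of_mem _ hU _ hpP p (by simp) (by simp))

theorem cutRight_glue (hpk : p < k) (hV : V ⊆ Ico k q) (hk : k ∈ V)
    {P Q : Finset (Finset ℕ)} (hP : IsNCPart (Ico p k) P) (hQ : IsNCPart (Ico k q) Q)
    (hVQ : V ∈ Q) : cutRight p k q V (glue p V P Q) = Q := by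
  ext U
  simp only [glue, cutRight, mem_insert, mem_union, mem_erase, mem_filter]
  constructor
  · rintro (rfl | ⟨⟨h, h' | h' | h'⟩, h''⟩)
    · exact hVQ
    · exact (h h').elim
    · obtain ⟨x, hx⟩ := hP.nonempty U h'.2
      have := mem_Ico.1 (h'' hx)
      have := mem_Ico.1 (hP.subset U h'.2 hx)
      omega
    · exact h'.2
  · intro hU
    by_cases h : U = V
    · exact Or.inl h
    · refine Or.inr ⟨⟨?_, Or.inr (Or.inr ⟨h, hU⟩)⟩, hQ.subset U hU⟩
      rintro rfl
      have := mem_Ico.1 (hQ.subset _ hU (mem_insert_self p V))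
      omega

theorem slotRel_glue_left {P Q : Finset (Finset ℕ)} (hpk : p < k) (hV : V ⊆ Ico k q)
    (hQ : IsNCPart (Ico k q) Q)
    {i j : ℕ} (hi : p ≤ i ∧ i < k) (hj : p ≤ j ∧ j < k) :
    SlotRel (glue p V P Q) i j ↔ SlotRel P i j := by
  have hVm : ∀ x ∈ V, k ≤ x ∧ x < q := fun x hx => mem_Ico.1 (hV hx)
  have hQm : ∀ U ∈ Q, ∀ x ∈ U, k ≤ x ∧ x < q := fun U hU x hx => mem_Ico.1 (hQ.subset U hU hx)
  constructor
  · intro h U hU x hx y hy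
    by_cases hUp : U = {p}
    · subst hUp
      rw [mem_singleton] at hx hy
      rw [hx, hy]
    · exact h U (by simp [glue, hUp, hU]) x hx y hy
  · intro h U hU x hx y hy
    simp only [glue, mem_insert, mem_union, mem_erase] at hU
    rcases hU with rfl | hU | hU
    · have : ∀ z ∈ insert p V, (z ≤ i ↔ z ≤ j) := by
        intro z hz
        rw [mem_insert] at hz
        rcases hz with rfl | hz
        · omega
        · have := hVm z hz; omega
      simp [this x hx, this y hy]
    · exact h U hU.2 x hx y hy
    · have := hQm U hU.2 x hx
      have := hQm U hU.2 y hy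
      omega

theorem slotRel_glue_right {P Q : Finset (Finset ℕ)} (hpk : p < k) (hk : k ∈ V)
    (hP : IsNCPart (Ico p k) P) (hVQ : V ∈ Q)
    {i j : ℕ} (hi : k ≤ i) (hj : k ≤ j) :
    SlotRel (glue p V P Q) i j ↔ SlotRel Q i j := by
  have hPm : ∀ U ∈ P, ∀ x ∈ U, p ≤ x ∧ x < k := fun U hU x hx => mem_Ico.1 (hP.subset U hU hx)
  constructor
  · intro h U hU x hx y hy
    by_cases hUp : U = V
    · subst hUp
      exact h (insert p U) (by simp [glue]) x (by simp [hx]) y (by simp [hy])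
    · exact h U (by simp [glue, hUp, hU]) x hx y hy
  · intro h U hU x hx y hy
    simp only [glue, mem_insert, mem_union, mem_erase] at hU
    rcases hU with rfl | hU | hU
    · have : ∀ z ∈ insert p V, (z ≤ i ↔ z ≤ j) := by
        intro z hz
        rw [mem_insert] at hz
        rcases hz with rfl | hz
        · omega
        · have := h V hVQ z hz k hk; omega
      simp [this x hx, this y hy]
    · have := hPm U hU.2 x hx
      have := hPm U hU.2 y hy
      omega
    · exact h U hU.2 x hx y hy

/-- The chord separates `p` from `k`, which are in one block. This is why the complement of a glued
partition splits at `k`. -/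
theorem not_slotRel_glue {P Q : Finset (Finset ℕ)} (hk : k ∈ V)
    {i j : ℕ} (hi : p ≤ i ∧ i < k) (hj : k ≤ j) :
    ¬ SlotRel (glue p V P Q) i j := by
  intro h
  have := h (insert p V) (by simp [glue]) p (by simp) k (by simp [hk])
  omega

theorem slotClass_glue_left {P Q : Finset (Finset ℕ)} (hpk : p < k) (hV : V ⊆ Ico k q)
    (hk : k ∈ V) (hQ : IsNCPart (Ico k q) Q) {i : ℕ} (hi : p ≤ i ∧ i < k) :
    slotClass p q (glue p V P Q) i = slotClass p k P i := by
  ext j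
  have hkq := mem_Ico.1 (hV hk)
  simp only [mem_slotClass]
  by_cases hj : j < k
  · constructor
    · rintro ⟨h1, h2⟩
      exact ⟨⟨h1.1, hj⟩, (slotRel_glue_left hpk hV hQ hi ⟨h1.1, hj⟩).1 h2⟩
    · rintro ⟨h1, h2⟩
      exact ⟨⟨h1.1, by omega⟩, (slotRel_glue_left hpk hV hQ hi ⟨h1.1, hj⟩).2 h2⟩
  · constructor
    · rintro ⟨h1, h2⟩
      exact (not_slotRel_glue hk hi (by omega) h2).elim
    · rintro ⟨h1, h2⟩
      omega

theorem slotClass_glue_right {P Q : Finset (Finset ℕ)} (hpk : p < k)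
    (hk : k ∈ V) (hP : IsNCPart (Ico p k) P) (hVQ : V ∈ Q) {i : ℕ} (hi : k ≤ i ∧ i < q) :
    slotClass p q (glue p V P Q) i = slotClass k q Q i := by
  ext j
  simp only [mem_slotClass]
  by_cases hj : j < k
  · constructor
    · rintro ⟨h1, h2⟩
      exact (not_slotRel_glue hk ⟨h1.1, hj⟩ hi.1 h2.symm).elim
    · rintro ⟨h1, h2⟩
      omega
  · have hjk : k ≤ j := by omega
    rw [slotRel_glue_right hpk hk hP hVQ hi.1 hjk]
    constructor
    · rintro ⟨h1, h2⟩; exact ⟨⟨hjk, h1.2⟩, h2⟩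
    · rintro ⟨h1, h2⟩; exact ⟨⟨by omega, h1.2⟩, h2⟩

theorem kr_glue {P Q : Finset (Finset ℕ)} (hpk : p < k) (hV : V ⊆ Ico k q)
    (hk : k ∈ V) (hP : IsNCPart (Ico p k) P) (hQ : IsNCPart (Ico k q) Q) (hVQ : V ∈ Q) :
    kr p q (glue p V P Q) = kr p k P ∪ kr k q Q := by
  have hkq := mem_Ico.1 (hV hk)
  ext W
  simp only [mem_union, mem_kr]
  constructor
  · rintro ⟨i, hi, rfl⟩
    by_cases hik : i < k
    · exact Or.inl ⟨i, ⟨hi.1, hik⟩, (slotClass_glue_left hpk hV hk hQ ⟨hi.1, hik⟩).symm⟩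
    · exact Or.inr ⟨i, ⟨by omega, hi.2⟩,
        (slotClass_glue_right hpk hk hP hVQ ⟨by omega, hi.2⟩).symm⟩
  · rintro (⟨i, hi, rfl⟩ | ⟨i, hi, rfl⟩)
    · exact ⟨i, by omega, slotClass_glue_left hpk hV hk hQ hi⟩
    · exact ⟨i, by omega, slotClass_glue_right hpk hk hP hVQ hi⟩

theorem disjoint_kr (P Q : Finset (Finset ℕ)) : Disjoint (kr p k P) (kr k q Q) := by
  rw [Finset.disjoint_left]
  intro W h1 h2
  rw [mem_kr] at h1 h2
  obtain ⟨i, hi, rfl⟩ := h1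
  obtain ⟨j, hj, e⟩ := h2
  have : i ∈ slotClass k q Q j := by
    rw [e, mem_slotClass]; exact ⟨hi, SlotRel.refl _ _⟩
  rw [mem_slotClass] at this
  omega

/-- Splitting off the first gap of the block of `p`. -/
theorem ncSumBlock_insert (f g : Finset ℕ → ℂ) (hpk : p < k) (hV : V ⊆ Ico k q) (hk : k ∈ V) :
    ncSumBlock f g (insert p V) p q = ncSumBlock f g {p} p k * ncSumBlock f g V k q := by
  simp only [ncSumBlock]
  rw [sum_mul_sum, ← sum_product']
  symm
  refine sum_nbij' (fun a => glue p V a.1 a.2) (fun P => (cutLeft p k V P, cutRight p k q V P))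
    ?_ ?_ ?_ ?_ ?_
  · rintro ⟨P, Q⟩ h
    simp only [mem_product, mem_filter, mem_ncp] at h ⊢
    exact ⟨glue_isNCPart hpk hV hk h.1.1 h.2.1 h.1.2 h.2.2, by simp [glue]⟩
  · intro P h
    simp only [mem_product, mem_filter, mem_ncp] at h ⊢
    exact ⟨⟨cutLeft_isNCPart hpk hV hk h.1 h.2, by simp [cutLeft]⟩,
      cutRight_isNCPart hpk hV hk h.1 h.2, by simp [cutRight]⟩
  · rintro ⟨P, Q⟩ h
    simp only [mem_product, mem_filter, mem_ncp] at h
    simp only [Prod.mk.injEq]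
    exact ⟨cutLeft_glue h.1.1 h.2.1 h.1.2, cutRight_glue hpk hV hk h.1.1 h.2.1 h.2.2⟩
  · intro P h
    simp only [mem_filter, mem_ncp] at h
    exact glue_cut hk h.1 h.2
  · rintro ⟨P, Q⟩ h
    simp only [mem_product, mem_filter, mem_ncp] at h
    obtain ⟨⟨hP, hpP⟩, hQ, hVQ⟩ := h
    have hnot : insert p V ∉ P.erase {p} ∪ Q.erase V := by
      simp only [mem_union, mem_erase, not_or, not_and]
      refine ⟨fun _ h => ?_, fun _ h => ?_⟩
      · have := mem_Ico.1 (hP.subset _ h (mem_insert_of_mem hk)); omega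
      · have := mem_Ico.1 (hQ.subset _ h (mem_insert_self p V)); omega
    have hdisj : Disjoint (P.erase {p}) (Q.erase V) := by
      rw [Finset.disjoint_left]
      intro U h1 h2
      obtain ⟨x, hx⟩ := hP.nonempty U (mem_of_mem_erase h1)
      have := mem_Ico.1 (hP.subset _ (mem_of_mem_erase h1) hx)
      have := mem_Ico.1 (hQ.subset _ (mem_of_mem_erase h2) hx)
      omega
    dsimp only
    rw [kr_glue hpk hV hk hP hQ hVQ, prod_union (disjoint_kr _ _), glue, erase_insert hnot,
      prod_union hdisj]
    ring

end Split

end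

/-! ### Ordered products of letters; partitions whose first point is a singleton. -/

section

variable {A : Type*}

/-- The list `x i₁, …, x iᵣ` for `U = {i₁ < ⋯ < iᵣ}`. -/
def letters (x : ℕ → A) (U : Finset ℕ) : List A := (U.sort (· ≤ ·)).map x

theorem sort_eq_of_pairwise {U : Finset ℕ} {l : List ℕ} (hl : l.Pairwise (· < ·))
    (hU : ∀ i, i ∈ l ↔ i ∈ U) : U.sort (· ≤ ·) = l := by
  have hnd : l.Nodup := hl.imp fun h => h.ne
  have : U = l.toFinset := by ext i; simp [hU]
  rw [this]
  exact (List.toFinset_sort (· ≤ ·) hnd).2 (hl.imp fun h => h.le)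

theorem sort_pairwise_lt (U : Finset ℕ) : (U.sort (· ≤ ·)).Pairwise (· < ·) :=
  (Finset.sortedLT_sort U).pairwise

theorem letters_congr {x y : ℕ → A} {U : Finset ℕ} (h : ∀ i ∈ U, x i = y i) :
    letters x U = letters y U := by
  refine List.map_congr_left fun i hi => h i ?_
  simpa using hi

@[simp]
theorem letters_empty (x : ℕ → A) : letters x ∅ = [] := by simp [letters]

@[simp]
theorem letters_singleton (x : ℕ → A) (i : ℕ) : letters x {i} = [x i] := by simp [letters]

theorem letters_insert_min (x : ℕ → A) {U : Finset ℕ} {p : ℕ} (h : ∀ y ∈ U, p < y) :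
    letters x (insert p U) = x p :: letters x U := by
  rw [letters, sort_eq_of_pairwise (l := p :: U.sort (· ≤ ·))]
  · rfl
  · rw [List.pairwise_cons]
    exact ⟨fun y hy => h y (by simpa using hy), sort_pairwise_lt U⟩
  · simp

theorem letters_insert_max (x : ℕ → A) {U : Finset ℕ} {m : ℕ} (h : ∀ y ∈ U, y < m) :
    letters x (insert m U) = letters x U ++ [x m] := by
  rw [letters, sort_eq_of_pairwise (l := U.sort (· ≤ ·) ++ [m])]
  · simp [letters]
  · rw [List.pairwise_append]
    refine ⟨sort_pairwise_lt U, by simp, fun a ha b hb => ?_⟩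
    rw [List.mem_singleton.1 hb]
    exact h a (by simpa using ha)
  · simp [or_comm]

theorem letters_image (x : ℕ → A) {e : ℕ → ℕ} (he : StrictMono e) (U : Finset ℕ) :
    letters x (U.image e) = letters (fun i => x (e i)) U := by
  rw [letters, sort_eq_of_pairwise (l := (U.sort (· ≤ ·)).map e)]
  · simp [letters, Function.comp_def]
  · exact List.Pairwise.map e (fun a b hab => he hab) (sort_pairwise_lt U)
  · simp

section Singleton

variable {p q : ℕ}

theorem insert_singleton_isNCPart (hpq : p < q) {Q : Finset (Finset ℕ)}
    (hQ : IsNCPart (Ico (p + 1) q) Q) : IsNCPart (Ico p q) (insert {p} Q) := by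
  have hQm : ∀ U ∈ Q, ∀ x ∈ U, p + 1 ≤ x ∧ x < q :=
    fun U hU x hx => mem_Ico.1 (hQ.subset U hU hx)
  refine ⟨?_, ?_, ?_, ?_, ?_⟩
  · intro U hU
    rcases mem_insert.1 hU with rfl | h
    · simp
    · exact hQ.nonempty U h
  · intro U hU x hx
    rw [mem_Ico]
    rcases mem_insert.1 hU with rfl | h
    · rw [mem_singleton] at hx; omega
    · have := hQm U h x hx; omega
  · intro x hx
    rw [mem_Ico] at hx
    by_cases hxp : x = p
    · exact ⟨{p}, by simp, by simp [hxp]⟩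
    · obtain ⟨U, hU, hxU⟩ := hQ.cover x (mem_Ico.2 (by omega))
      exact ⟨U, by simp [hU], hxU⟩
  · intro U hU W hW x hxU hxW
    rcases mem_insert.1 hU with rfl | hU <;> rcases mem_insert.1 hW with rfl | hW
    · rfl
    · have := hQm W hW x hxW; rw [mem_singleton] at hxU; omega
    · have := hQm U hU x hxU; rw [mem_singleton] at hxW; omega
    · exact hQ.eq_of_mem U hU W hW x hxU hxW
  · intro U hU W hW a b c e hab hbc hce ha hc hb he
    rcases mem_insert.1 hU with rfl | hU <;> rcases mem_insert.1 hW with rfl | hW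
    · rfl
    · rw [mem_singleton] at ha hc; omega
    · rw [mem_singleton] at hb he; omega
    · exact hQ.noncross U hU W hW a b c e hab hbc hce ha hc hb he

theorem erase_singleton_isNCPart {P : Finset (Finset ℕ)}
    (hP : IsNCPart (Ico p q) P) (hpP : {p} ∈ P) : IsNCPart (Ico (p + 1) q) (P.erase {p}) := by
  refine ⟨?_, ?_, ?_, ?_, ?_⟩
  · intro U hU
    exact hP.nonempty U (mem_of_mem_erase hU)
  · intro U hU x hx
    rw [mem_erase] at hU
    have h1 := mem_Ico.1 (hP.subset U hU.2 hx)
    have h2 : x ≠ p := by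
      rintro rfl
      exact hU.1 (hP.eq_of_mem U hU.2 _ hpP x hx (by simp))
    rw [mem_Ico]
    omega
  · intro x hx
    rw [mem_Ico] at hx
    obtain ⟨U, hU, hxU⟩ := hP.cover x (mem_Ico.2 (by omega))
    refine ⟨U, mem_erase.2 ⟨?_, hU⟩, hxU⟩
    rintro rfl
    rw [mem_singleton] at hxU
    omega
  · intro U hU W hW
    exact hP.eq_of_mem U (mem_of_mem_erase hU) W (mem_of_mem_erase hW)
  · intro U hU W hW
    exact hP.noncross U (mem_of_mem_erase hU) W (mem_of_mem_erase hW)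

theorem singleton_notMem_of_isNCPart {Q : Finset (Finset ℕ)}
    (hQ : IsNCPart (Ico (p + 1) q) Q) : {p} ∉ Q := by
  intro h
  have := mem_Ico.1 (hQ.subset _ h (mem_singleton_self p))
  omega

theorem sum_ncp_singleton (hpq : p < q) (F : Finset (Finset ℕ) → ℂ) :
    ∑ P ∈ ncp p q with {p} ∈ P, F P = ∑ Q ∈ ncp (p + 1) q, F (insert {p} Q) := by
  refine sum_nbij' (fun P => P.erase {p}) (fun Q => insert {p} Q) ?_ ?_ ?_ ?_ ?_
  · intro P h
    simp only [mem_filter, mem_ncp] at h ⊢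
    exact erase_singleton_isNCPart h.1 h.2
  · intro Q h
    simp only [mem_filter, mem_ncp] at h ⊢
    exact ⟨insert_singleton_isNCPart hpq h, by simp⟩
  · intro P h
    exact insert_erase (mem_filter.1 h).2
  · intro Q h
    exact erase_insert (singleton_notMem_of_isNCPart (mem_ncp.1 h))
  · intro P h
    rw [insert_erase (mem_filter.1 h).2]

theorem slotRel_insert_singleton {Q : Finset (Finset ℕ)} {i j : ℕ} :
    SlotRel (insert {p} Q) i j ↔ SlotRel Q i j := by
  constructor
  · intro h U hU
    exact h U (by simp [hU])
  · intro h U hU x hx y hy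
    rcases mem_insert.1 hU with rfl | hU
    · rw [mem_singleton] at hx hy
      rw [hx, hy]
    · exact h U hU x hx y hy

/-- All of `[p + 1, q)` lies under this chord, so no block is cut: on the circle, only the point `p`
separates the two slots. -/
theorem slotRel_first_last {Q : Finset (Finset ℕ)} (hQ : IsNCPart (Ico (p + 1) q) Q) :
    SlotRel Q p (q - 1) := by
  intro U hU x hx y hy
  have := mem_Ico.1 (hQ.subset _ hU hx)
  have := mem_Ico.1 (hQ.subset _ hU hy)
  omega

theorem slotClass_insert_singleton_last {Q : Finset (Finset ℕ)} (hpq : p < q)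
    (hQ : IsNCPart (Ico (p + 1) q) Q) :
    slotClass p q (insert {p} Q) (q - 1) = insert p (slotClass (p + 1) q Q (q - 1)) := by
  ext j
  rw [mem_insert, mem_slotClass, mem_slotClass, slotRel_insert_singleton]
  by_cases hj : j = p
  · subst hj
    simp [hpq, (slotRel_first_last hQ).symm]
  · simp only [hj, false_or]
    exact and_congr_left fun _ => by omega

theorem slotClass_insert_singleton {Q : Finset (Finset ℕ)}
    (hQ : IsNCPart (Ico (p + 1) q) Q) {i : ℕ} (hi : ¬ SlotRel Q i (q - 1)) :
    slotClass p q (insert {p} Q) i = slotClass (p + 1) q Q i := by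
  ext j
  rw [mem_slotClass, mem_slotClass, slotRel_insert_singleton]
  refine and_congr_left fun h => ?_
  have : j ≠ p := by
    rintro rfl
    exact hi (h.trans (slotRel_first_last hQ))
  omega

theorem kr_insert_singleton {Q : Finset (Finset ℕ)} (hpq : p + 1 < q)
    (hQ : IsNCPart (Ico (p + 1) q) Q) :
    kr p q (insert {p} Q) = insert (insert p (slotClass (p + 1) q Q (q - 1)))
      ((kr (p + 1) q Q).erase (slotClass (p + 1) q Q (q - 1))) := by
  ext W
  simp only [mem_insert, mem_erase, mem_kr]
  constructor
  · rintro ⟨i, hi, rfl⟩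
    by_cases h : SlotRel Q i (q - 1)
    · left
      rw [slotClass_congr (slotRel_insert_singleton.2 h),
        slotClass_insert_singleton_last (by omega) hQ]
    · right
      rw [slotClass_insert_singleton hQ h]
      have hip : i ≠ p := by
        rintro rfl
        exact h (slotRel_first_last hQ)
      refine ⟨fun e => h ?_, i, by omega, rfl⟩
      have : q - 1 ∈ slotClass (p + 1) q Q i := by
        rw [e, mem_slotClass]
        exact ⟨by omega, SlotRel.refl _ _⟩
      exact (mem_slotClass.1 this).2
  · rintro (rfl | ⟨hne, i, hi, rfl⟩)
    · exact ⟨q - 1, by omega, slotClass_insert_singleton_last (by omega) hQ⟩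
    · refine ⟨i, by omega, slotClass_insert_singleton hQ fun h => hne (slotClass_congr h)⟩

end Singleton

variable [Ring A] [Algebra ℂ A]

/-- `φ(x_{i₁} ⋯ x_{iᵣ})` for `U = {i₁ < ⋯ < iᵣ}`. -/
def mom (φ : A →ₗ[ℂ] ℂ) (x : ℕ → A) (U : Finset ℕ) : ℂ := φ (letters x U).prod

/-- If `p` is a singleton, then the slot after `p` belongs to the last slot of the remaining
partition of `[p + 1, q)`. -/
theorem ncSumBlock_singleton (φ : A →ₗ[ℂ] ℂ) (hφ : ∀ x y : A, φ (x * y) = φ (y * x))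
    (f : Finset ℕ → ℂ) (d : ℕ → A) {p q : ℕ} (hpq : p + 1 < q) :
    ncSumBlock f (mom φ d) {p} p q =
      ncSum f (mom φ (Function.update d (q - 1) (d (q - 1) * d p))) (p + 1) q := by
  rw [ncSumBlock, sum_ncp_singleton (by omega), ncSum]
  refine sum_congr rfl fun Q hQ => ?_
  rw [mem_ncp] at hQ
  rw [erase_insert (singleton_notMem_of_isNCPart hQ), kr_insert_singleton hpq hQ]
  congr 1
  set W₀ := slotClass (p + 1) q Q (q - 1) with hW₀
  have hm : ∀ W ∈ kr (p + 1) q Q, ∀ j ∈ W, p + 1 ≤ j ∧ j < q := by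
    intro W hW j hj
    obtain ⟨i, -, rfl⟩ := mem_kr.1 hW
    exact (mem_slotClass.1 hj).1
  have hW₀m : W₀ ∈ kr (p + 1) q Q := mem_kr.2 ⟨q - 1, by omega, rfl⟩
  have hlast : q - 1 ∈ W₀ := mem_slotClass.2 ⟨by omega, SlotRel.refl _ _⟩
  have hnot : insert p W₀ ∉ (kr (p + 1) q Q).erase W₀ := by
    intro h
    have := hm _ (mem_of_mem_erase h) p (by simp)
    omega
  rw [prod_insert hnot, ← mul_prod_erase _ _ hW₀m]
  congr 1
  · have h1 : W₀ = insert (q - 1) (W₀.erase (q - 1)) := (insert_erase hlast).symm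
    have h2 : ∀ y ∈ W₀.erase (q - 1), y < q - 1 := by
      intro y hy
      have := hm _ hW₀m y (mem_of_mem_erase hy)
      have := ne_of_mem_erase hy
      omega
    -- In the merged class `p` is the first index and `q - 1` the last; the trace moves the factor
    -- `d p` from the front to directly behind `d (q - 1)`.
    rw [mom, letters_insert_min d (fun y hy => (hm _ hW₀m y hy).1), List.prod_cons, hφ, mom, h1,
      letters_insert_max _ h2, letters_insert_max _ h2]
    simp only [List.prod_append, List.prod_singleton, Function.update_self]
    rw [mul_assoc, letters_congr (x := d)]
    intro i hi
    rw [Function.update_of_ne (ne_of_mem_erase hi)]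
  · refine prod_congr rfl fun W hW => ?_
    rw [mom, mom, letters_congr]
    intro i hi
    rw [Function.update_of_ne]
    rintro rfl
    obtain ⟨j, hj, rfl⟩ := mem_kr.1 (mem_of_mem_erase hW)
    exact (ne_of_mem_erase hW) (slotClass_congr (mem_slotClass.1 hi).2)

theorem ncSumBlock_singleton_one (f : Finset ℕ → ℂ) {p q : ℕ} (hpq : p < q) :
    ncSumBlock f (fun _ => 1) {p} p q = ncSum f (fun _ => 1) (p + 1) q := by
  rw [ncSumBlock, sum_ncp_singleton hpq, ncSum]
  refine sum_congr rfl fun Q hQ => ?_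
  rw [erase_insert (singleton_notMem_of_isNCPart (mem_ncp.1 hQ))]
  simp

theorem ncp_self (p : ℕ) : ncp p p = {∅} := by
  ext P
  rw [mem_ncp, mem_singleton]
  constructor
  · intro h
    rw [eq_empty_iff_forall_notMem]
    intro U hU
    obtain ⟨x, hx⟩ := h.nonempty U hU
    simpa using h.subset U hU hx
  · rintro rfl
    constructor <;> simp

theorem ncSum_self (f g : Finset ℕ → ℂ) (p : ℕ) : ncSum f g p p = 1 := by
  simp [ncSum, ncp_self, kr]

/-- The case left out of `ncSumBlock_singleton`: when `p` is the only point, there is no later slot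
that could absorb the slot after `p`. -/
theorem ncSumBlock_singleton_succ (f g : Finset ℕ → ℂ) (p : ℕ) :
    ncSumBlock f g {p} p (p + 1) = g {p} := by
  rw [ncSumBlock, sum_ncp_singleton (by omega), ncp_self, sum_singleton]
  have : kr p (p + 1) (insert {p} ∅) = {{p}} := by
    have h : slotClass p (p + 1) {{p}} p = {p} := by
      ext j
      rw [mem_slotClass, mem_singleton]
      constructor
      · omega
      · rintro rfl
        exact ⟨by omega, SlotRel.refl _ _⟩
    simp [kr, h]
  rw [this]
  simp

end

/-! ### Transfer from `Fin n` to intervals; the moment-cumulant formula. -/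

section

section Transfer

variable {n : ℕ}

/-- The order embedding `i ↦ p + i` of `Fin n` into the natural numbers. -/
def shiftEmb (p n : ℕ) : Fin n ↪ ℕ := ⟨fun i => p + i, fun i j h => Fin.ext (by simpa using h)⟩

@[simp]
theorem shiftEmb_apply (p n : ℕ) (i : Fin n) : shiftEmb p n i = p + i := rfl

/-- The partition of `[p, p + n)` corresponding to a partition of `Fin n`. -/
def toNat (p : ℕ) (π : Part n) : Finset (Finset ℕ) :=
  π.parts.map (Finset.mapEmbedding (shiftEmb p n)).toEmbedding

theorem mem_toNat {p : ℕ} {π : Part n} {U : Finset ℕ} :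
    U ∈ toNat p π ↔ ∃ V ∈ π.parts, V.map (shiftEmb p n) = U := by
  simp [toNat]

theorem prod_toNat (p : ℕ) (π : Part n) (f : Finset ℕ → ℂ) :
    ∏ U ∈ toNat p π, f U = ∏ V ∈ π.parts, f (V.map (shiftEmb p n)) := by
  simp [toNat]

theorem mem_map_shiftEmb {p : ℕ} {V : Finset (Fin n)} {x : ℕ} :
    x ∈ V.map (shiftEmb p n) ↔ ∃ i ∈ V, p + (i : ℕ) = x := by
  simp

theorem toNat_isNCPart {p : ℕ} {π : Part n} (hπ : IsNonCrossing π) :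
    IsNCPart (Ico p (p + n)) (toNat p π) := by
  refine ⟨?_, ?_, ?_, ?_, ?_⟩
  · intro U hU
    obtain ⟨V, hV, rfl⟩ := mem_toNat.1 hU
    simpa using π.nonempty_of_mem_parts hV
  · intro U hU x hx
    obtain ⟨V, hV, rfl⟩ := mem_toNat.1 hU
    obtain ⟨i, -, rfl⟩ := mem_map_shiftEmb.1 hx
    rw [mem_Ico]
    omega
  · intro x hx
    rw [mem_Ico] at hx
    let i : Fin n := ⟨x - p, by omega⟩
    refine ⟨(π.part i).map (shiftEmb p n), mem_toNat.2 ⟨_, π.part_mem.2 (mem_univ i), rfl⟩,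
      mem_map_shiftEmb.2 ⟨i, π.mem_part (mem_univ i), ?_⟩⟩
    simp only [i]
    omega
  · intro U hU W hW x hxU hxW
    obtain ⟨V, hV, rfl⟩ := mem_toNat.1 hU
    obtain ⟨V', hV', rfl⟩ := mem_toNat.1 hW
    obtain ⟨i, hi, rfl⟩ := mem_map_shiftEmb.1 hxU
    obtain ⟨j, hj, e⟩ := mem_map_shiftEmb.1 hxW
    obtain rfl : j = i := Fin.ext (by omega)
    rw [π.eq_of_mem_parts hV hV' hi hj]
  · intro U hU W hW a b c e hab hbc hce ha hc hb he
    obtain ⟨V, hV, rfl⟩ := mem_toNat.1 hU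
    obtain ⟨V', hV', rfl⟩ := mem_toNat.1 hW
    obtain ⟨a, ha', rfl⟩ := mem_map_shiftEmb.1 ha
    obtain ⟨b, hb', rfl⟩ := mem_map_shiftEmb.1 hb
    obtain ⟨c, hc', rfl⟩ := mem_map_shiftEmb.1 hc
    obtain ⟨e, he', rfl⟩ := mem_map_shiftEmb.1 he
    rw [hπ V hV V' hV' a b c e (by rw [Fin.lt_def]; omega) (by rw [Fin.lt_def]; omega)
      (by rw [Fin.lt_def]; omega) ha' hc' hb' he']

theorem toNat_injective (p : ℕ) : Function.Injective (toNat p : Part n → Finset (Finset ℕ)) := by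
  intro π π' h
  exact Finpartition.ext (Finset.map_injective _ h)

theorem exists_toNat_eq {p : ℕ} {P : Finset (Finset ℕ)} (hP : IsNCPart (Ico p (p + n)) P) :
    ∃ π : Part n, IsNonCrossing π ∧ toNat p π = P := by
  classical
  let r : Finset ℕ → Finset (Fin n) := fun U => {i | p + (i : ℕ) ∈ U}
  have hr : ∀ U ∈ P, (r U).map (shiftEmb p n) = U := by
    intro U hU
    ext x
    rw [mem_map_shiftEmb]
    constructor
    · rintro ⟨i, hi, rfl⟩
      simpa [r] using hi
    · intro hx
      have := mem_Ico.1 (hP.subset U hU hx)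
      have e : p + (x - p) = x := by omega
      exact ⟨⟨x - p, by omega⟩, by simp [r, e, hx], e⟩
  let π : Part n := Finpartition.ofExistsUnique (P.image r) (fun _ _ => subset_univ _)
    (by
      intro i _
      obtain ⟨U, hU, hi⟩ := hP.cover (p + i) (mem_Ico.2 (by omega))
      refine ⟨r U, ⟨mem_image_of_mem r hU, by simp [r, hi]⟩, ?_⟩
      rintro V ⟨hV, hiV⟩
      obtain ⟨W, hW, rfl⟩ := mem_image.1 hV
      rw [hP.eq_of_mem U hU W hW (p + i) hi (by simpa [r] using hiV)])
    (by
      intro h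
      obtain ⟨U, hU, e⟩ := mem_image.1 h
      have h1 := hr U hU
      rw [e, map_empty] at h1
      have h2 := hP.nonempty U hU
      rw [← h1] at h2
      simp at h2)
  have hπ : π.parts = P.image r := rfl
  refine ⟨π, ?_, ?_⟩
  · intro V hV W hW i j k l hij hjk hkl hi hk hj hl
    rw [hπ] at hV hW
    obtain ⟨U, hU, rfl⟩ := mem_image.1 hV
    obtain ⟨U', hU', rfl⟩ := mem_image.1 hW
    simp only [r, mem_filter, mem_univ, true_and] at hi hk hj hl
    rw [hP.noncross U hU U' hU' (p + i) (p + j) (p + k) (p + l) (by rw [Fin.lt_def] at hij; omega)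
      (by rw [Fin.lt_def] at hjk; omega) (by rw [Fin.lt_def] at hkl; omega) hi hk hj hl]
  · ext U
    rw [mem_toNat, hπ]
    constructor
    · rintro ⟨V, hV, rfl⟩
      obtain ⟨U, hU, rfl⟩ := mem_image.1 hV
      rwa [hr U hU]
    · intro hU
      exact ⟨r U, mem_image_of_mem r hU, hr U hU⟩

theorem mem_NC {π : Part n} : π ∈ NC n ↔ IsNonCrossing π := by simp [NC]

/-- The offset `p` is free because two are needed: 1 for `NC n`, so that points are labels, and 2
for pairings of `2 n` points, so that the points become `2 i` and `2 i + 1` with `1 ≤ i ≤ n`. -/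
theorem sum_NC (p : ℕ) (C : Finset (Finset ℕ) → Prop) [DecidablePred C]
    (S : Finset (Part n)) (hS : ∀ π, π ∈ S ↔ π ∈ NC n ∧ C (toNat p π))
    (F : Finset (Finset ℕ) → ℂ) :
    ∑ π ∈ S, F (toNat p π) = ∑ P ∈ ncp p (p + n) with C P, F P := by
  refine sum_nbij (toNat p) ?_ ?_ ?_ ?_
  · intro π h
    rw [hS, mem_NC] at h
    exact mem_filter.2 ⟨mem_ncp.2 (toNat_isNCPart h.1), h.2⟩
  · exact (toNat_injective p).injOn
  · intro P hP
    obtain ⟨h1, h2⟩ := mem_filter.1 (mem_coe.1 hP)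
    obtain ⟨π, hπ, rfl⟩ := exists_toNat_eq (mem_ncp.1 h1)
    exact ⟨π, mem_coe.2 ((hS π).2 ⟨mem_NC.2 hπ, h2⟩), rfl⟩
  · intro _ _; rfl

theorem slotRel_toNat {p : ℕ} {π : Part n} {i j : Fin n} :
    SlotRel (toNat p π) (p + i) (p + j) ↔ (krewerasSetoid π) i j := by
  constructor
  · intro h V hV x hx y hy
    have := h _ (mem_toNat.2 ⟨V, hV, rfl⟩) (p + x) (mem_map_shiftEmb.2 ⟨x, hx, rfl⟩)
      (p + y) (mem_map_shiftEmb.2 ⟨y, hy, rfl⟩)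
    simp only [Nat.add_le_add_iff_left] at this
    exact this
  · intro h U hU x hx y hy
    obtain ⟨V, hV, rfl⟩ := mem_toNat.1 hU
    obtain ⟨x, hx', rfl⟩ := mem_map_shiftEmb.1 hx
    obtain ⟨y, hy', rfl⟩ := mem_map_shiftEmb.1 hy
    have := h V hV x hx' y hy'
    simp only [Nat.add_le_add_iff_left]
    exact this

theorem map_part_kreweras (p : ℕ) (π : Part n) (i : Fin n) :
    ((kreweras π).part i).map (shiftEmb p n) = slotClass p (p + n) (toNat p π) (p + i) := by
  classical
  ext x
  rw [mem_map_shiftEmb, mem_slotClass]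
  have key : ∀ j, j ∈ (kreweras π).part i ↔ (krewerasSetoid π) i j := fun j =>
    Finpartition.mem_part_ofSetoid_iff_rel
  constructor
  · rintro ⟨j, hj, rfl⟩
    exact ⟨by omega, slotRel_toNat.2 ((key j).1 hj)⟩
  · rintro ⟨hx, h⟩
    have e : p + (x - p) = x := by omega
    refine ⟨⟨x - p, by omega⟩, (key _).2 (slotRel_toNat (p := p).1 ?_), e⟩
    simpa only [e] using h

theorem toNat_kreweras (p : ℕ) (π : Part n) :
    toNat p (kreweras π) = kr p (p + n) (toNat p π) := by
  ext W
  rw [mem_toNat, mem_kr]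
  constructor
  · rintro ⟨V, hV, rfl⟩
    obtain ⟨i, hi⟩ := (kreweras π).nonempty_of_mem_parts hV
    rw [← (kreweras π).part_eq_of_mem hV hi]
    exact ⟨p + i, by omega, (map_part_kreweras p π i).symm⟩
  · rintro ⟨x, hx, rfl⟩
    have e : p + (x - p) = x := by omega
    refine ⟨_, (kreweras π).part_mem.2 (mem_univ ⟨x - p, by omega⟩), ?_⟩
    rw [map_part_kreweras]
    simp only [e]

variable {A : Type*}

theorem letters_map_shiftEmb {p : ℕ} {a : Fin n → A} {x : ℕ → A} (h : ∀ i, a i = x (p + i))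
    (V : Finset (Fin n)) :
    letters x (V.map (shiftEmb p n)) = List.ofFn fun i => a (V.orderEmbOfFin rfl i) := by
  rw [letters, sort_eq_of_pairwise (l := List.ofFn fun i => p + (V.orderEmbOfFin rfl i : ℕ))]
  · simp [List.map_ofFn, h, Function.comp_def]
  · rw [List.pairwise_ofFn]
    intro i j hij
    have := (V.orderEmbOfFin rfl).strictMono hij
    rw [Fin.lt_def] at this
    omega
  · intro x
    rw [List.mem_ofFn', mem_map_shiftEmb]
    constructor
    · rintro ⟨i, rfl⟩
      exact ⟨_, V.orderEmbOfFin_mem rfl i, rfl⟩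
    · rintro ⟨j, hj, rfl⟩
      have : j ∈ Set.range (V.orderEmbOfFin rfl) := by simpa using hj
      obtain ⟨i, rfl⟩ := this
      exact ⟨i, rfl⟩

variable [Ring A] [Algebra ℂ A]

theorem moment_restrict (φ : A →ₗ[ℂ] ℂ) {p : ℕ} {a : Fin n → A} {x : ℕ → A}
    (h : ∀ i, a i = x (p + i)) (V : Finset (Fin n)) :
    moment φ (restrict a V) = mom φ x (V.map (shiftEmb p n)) := by
  rw [mom, letters_map_shiftEmb h]
  rfl

theorem partMoment_eq (φ : A →ₗ[ℂ] ℂ) {p : ℕ} {a : Fin n → A} {x : ℕ → A}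
    (h : ∀ i, a i = x (p + i)) (π : Part n) :
    partMoment φ π a = ∏ U ∈ toNat p π, mom φ x U := by
  rw [prod_toNat, partMoment]
  exact prod_congr rfl fun V _ => moment_restrict φ h V

/-- The free cumulant of the entries of a list. -/
def listCumulant (φ : A →ₗ[ℂ] ℂ) (l : List A) : ℂ := freeCumulant φ l.length l.get

theorem freeCumulant_cast (φ : A →ₗ[ℂ] ℂ) {n m : ℕ} (h : n = m) (a : Fin n → A) (b : Fin m → A)
    (hab : ∀ i, a i = b (Fin.cast h i)) : freeCumulant φ n a = freeCumulant φ m b := by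
  subst h
  congr 1
  funext i
  exact hab i

/-- Lists remove the dependence of the index type `Fin V.card` on the block, so that cumulants of
equal lists can be compared. -/
theorem freeCumulant_eq_listCumulant (φ : A →ₗ[ℂ] ℂ) (a : Fin n → A) :
    freeCumulant φ n a = listCumulant φ (List.ofFn a) :=
  freeCumulant_cast φ (by simp) _ _ fun i => by simp

/-- The free cumulant of `x_{i₁}, …, x_{iᵣ}` for `U = {i₁ < ⋯ < iᵣ}`. -/
def cum (φ : A →ₗ[ℂ] ℂ) (x : ℕ → A) (U : Finset ℕ) : ℂ := listCumulant φ (letters x U)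

theorem freeCumulant_restrict (φ : A →ₗ[ℂ] ℂ) {p : ℕ} {a : Fin n → A} {x : ℕ → A}
    (h : ∀ i, a i = x (p + i)) (V : Finset (Fin n)) :
    freeCumulant φ V.card (restrict a V) = cum φ x (V.map (shiftEmb p n)) := by
  rw [cum, letters_map_shiftEmb h, freeCumulant_eq_listCumulant]
  rfl

theorem parts_top (hn : 0 < n) : (⊤ : Part n).parts = {univ} := by
  have h1 := Finpartition.parts_top_subset (univ : Finset (Fin n))
  rcases Finset.subset_singleton_iff.1 h1 with h | h
  · have h3 := (⊤ : Part n).part_mem.2 (mem_univ (⟨0, hn⟩ : Fin n))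
    rw [h] at h3
    simp at h3
  · exact h

theorem top_mem_NC (hn : 0 < n) : (⊤ : Part n) ∈ NC n := by
  rw [mem_NC]
  intro V hV W hW
  rw [parts_top hn, mem_singleton] at hV hW
  rw [hV, hW]
  simp

theorem moment_eq_sum_freeCumulant (φ : A →ₗ[ℂ] ℂ) (hn : 0 < n) (a : Fin n → A) :
    moment φ a = ∑ π ∈ NC n, ∏ V ∈ π.parts, freeCumulant φ V.card (restrict a V) := by
  classical
  rw [← add_sum_erase _ _ (top_mem_NC hn), parts_top hn, prod_singleton]
  have h1 : freeCumulant φ (univ : Finset (Fin n)).card (restrict a univ) = freeCumulant φ n a := by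
    refine freeCumulant_cast φ (by simp) _ _ fun i => ?_
    have := Finset.orderEmbOfFin_unique (s := (univ : Finset (Fin n))) rfl
      (f := Fin.cast (by simp)) (fun _ => mem_univ _) (Fin.cast_strictMono _)
    rw [restrict, ← this]
  rw [h1, freeCumulant]
  have h2 : ∑ π : {π : Part n // π ∈ NC n ∧ π ≠ ⊤}, ∏ V : {V // V ∈ π.1.parts},
      freeCumulant φ V.1.card (restrict a V.1) =
      ∑ π ∈ (NC n).erase ⊤, ∏ V ∈ π.parts, freeCumulant φ V.card (restrict a V) := by
    rw [Finset.sum_subtype (p := fun π => π ∈ NC n ∧ π ≠ ⊤) _ (by simp [and_comm])]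
    refine sum_congr (by congr) fun π _ => ?_
    exact Finset.prod_coe_sort π.1.parts fun V => freeCumulant φ V.card (restrict a V)
  rw [← h2]
  ring

/-- The moment-cumulant formula on an interval. -/
theorem mom_Ico_eq_ncSum (φ : A →ₗ[ℂ] ℂ) (hφ : φ 1 = 1) (x : ℕ → A) {p q : ℕ} (hpq : p ≤ q) :
    mom φ x (Ico p q) = ncSum (cum φ x) (fun _ => 1) p q := by
  obtain ⟨n, rfl⟩ := Nat.exists_eq_add_of_le hpq
  rcases Nat.eq_zero_or_pos n with rfl | hn
  · simp [ncSum_self, mom, hφ]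
  · let a : Fin n → A := fun i => x (p + i)
    have ha : ∀ i, a i = x (p + i) := fun _ => rfl
    have h1 : mom φ x (Ico p (p + n)) = moment φ a := by
      rw [mom, letters, sort_eq_of_pairwise (l := List.ofFn fun i : Fin n => p + (i : ℕ))]
      · rw [List.map_ofFn]; rfl
      · rw [List.pairwise_ofFn]
        intro i j hij
        rw [Fin.lt_def] at hij
        omega
      · intro i
        rw [List.mem_ofFn', mem_Ico]
        constructor
        · rintro ⟨j, rfl⟩
          dsimp only
          omega
        · intro h
          exact ⟨⟨i - p, by omega⟩, by simp; omega⟩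
    rw [h1, moment_eq_sum_freeCumulant φ hn]
    have h2 := sum_NC p (fun _ => True) (NC n) (by simp)
      (fun P : Finset (Finset ℕ) => ∏ U ∈ P, cum φ x U)
    rw [filter_true] at h2
    simp only [ncSum, prod_const_one, mul_one]
    rw [← h2]
    refine sum_congr rfl fun π _ => ?_
    rw [prod_toNat]
    exact prod_congr rfl fun V _ => freeCumulant_restrict φ ha V

end Transfer

end

/-! ### Cumulants of a semicircular variable and the recursion for words in `s`. -/

section

section Words

variable {A : Type*}

theorem letters_const (s : A) (U : Finset ℕ) :
    letters (fun _ => s) U = List.replicate U.card s := by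
  rw [letters, List.map_const', Finset.length_sort]

variable [Ring A] (s : A)

/-- The product of a word in `s`, written `none`, and elements of `A`. -/
def wprod (W : List (Option A)) : A := (W.map fun a => a.getD s).prod

@[simp]
theorem wprod_nil : wprod s [] = 1 := rfl

@[simp]
theorem wprod_none (W : List (Option A)) : wprod s (none :: W) = s * wprod s W := rfl

@[simp]
theorem wprod_some (y : A) (W : List (Option A)) : wprod s (some y :: W) = y * wprod s W := rfl

@[simp]
theorem wprod_append (U W : List (Option A)) : wprod s (U ++ W) = wprod s U * wprod s W := by
  simp [wprod]

theorem letters_Ico_getD (l : List A) {p q : ℕ} (hq : q ≤ l.length) :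
    letters (fun i => l.getD i 0) (Ico p q) = (l.drop p).take (q - p) := by
  rw [letters, sort_eq_of_pairwise (l := List.range' p (q - p)) List.pairwise_lt_range'
    (by intro i; simp; omega)]
  refine List.ext_getElem (by simp; omega) fun i h1 h2 => ?_
  simp at h1
  simp
  rw [List.getElem?_eq_getElem (by omega)]
  rfl

end Words

variable {A : Type*} [Ring A] [Algebra ℂ A]

section Cumulants

variable {φ : A →ₗ[ℂ] ℂ}

/-- The block `{p, j}` leaves two gaps, and the moment-cumulant formula sums each of them to a full
moment. -/
theorem ncSumBlock_cum_pair (hφ : φ 1 = 1) (x : ℕ → A) {p j q : ℕ} (hpj : p < j) (hjq : j < q) :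
    ncSumBlock (cum φ x) (fun _ => 1) {p, j} p q =
      mom φ x (Ico (p + 1) j) * mom φ x (Ico (j + 1) q) := by
  rw [ncSumBlock_insert (k := j) _ _ hpj (by simp [hjq]) (by simp),
    ncSumBlock_singleton_one _ hpj, ncSumBlock_singleton_one _ hjq,
    mom_Ico_eq_ncSum φ hφ x hpj, mom_Ico_eq_ncSum φ hφ x hjq]

/-- Used twice: with `C` always true to compute the cumulants of `s`, and with `C j` saying that the
letter at `j` has the colour of `s`. -/
theorem sum_pair_blocks (hφ : φ 1 = 1) (x : ℕ → A) (C : ℕ → Prop) [DecidablePred C] {p q : ℕ}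
    (hp : C p) :
    ∑ V ∈ (Ico p q).powerset with p ∈ V, (if V.card = 2 ∧ ∀ i ∈ V, C i then 1 else 0) *
        ncSumBlock (cum φ x) (fun _ => 1) V p q =
      ∑ j ∈ Ioo p q with C j, mom φ x (Ico (p + 1) j) * mom φ x (Ico (j + 1) q) := by
  simp only [ite_mul, one_mul, zero_mul]
  rw [← sum_filter, filter_filter]
  symm
  refine sum_bij (fun j _ => {p, j}) ?_ ?_ ?_ ?_
  · intro j hj
    simp only [mem_filter, mem_Ioo] at hj
    simp only [mem_filter, mem_powerset]
    refine ⟨?_, by simp, card_pair (by omega), ?_⟩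
    · intro i hi
      rw [mem_insert, mem_singleton] at hi
      rw [mem_Ico]
      omega
    · intro i hi
      rw [mem_insert, mem_singleton] at hi
      rcases hi with rfl | rfl
      · exact hp
      · exact hj.2
  · intro i hi j hj e
    simp only [mem_filter, mem_Ioo] at hi hj
    have : i ∈ ({p, j} : Finset ℕ) := e ▸ by simp
    rw [mem_insert, mem_singleton] at this
    omega
  · intro V hV
    simp only [mem_filter, mem_powerset] at hV
    obtain ⟨hV, hpV, hcard, hC⟩ := hV
    obtain ⟨j, hj⟩ := card_eq_one.1 (show (V.erase p).card = 1 by rw [card_erase_of_mem hpV, hcard])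
    have hjV : j ∈ V.erase p := by simp [hj]
    have h1 := mem_Ico.1 (hV (mem_of_mem_erase hjV))
    have h2 := ne_of_mem_erase hjV
    refine ⟨j, ?_, ?_⟩
    · simp only [mem_filter, mem_Ioo]
      exact ⟨by omega, hC j (mem_of_mem_erase hjV)⟩
    · rw [← hj, insert_erase hpV]
  · intro j hj
    simp only [mem_filter, mem_Ioo] at hj
    rw [ncSumBlock_cum_pair hφ x hj.1.1 hj.1.2]

theorem ncSumBlock_full (f : Finset ℕ → ℂ) {p q : ℕ} (hpq : p < q) :
    ncSumBlock f (fun _ => 1) (Ico p q) p q = 1 := by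
  have : (ncp p q).filter (Ico p q ∈ ·) = {{Ico p q}} := by
    ext P
    rw [mem_filter, mem_ncp, mem_singleton]
    constructor
    · rintro ⟨hP, h⟩
      ext U
      rw [mem_singleton]
      constructor
      · intro hU
        obtain ⟨x, hx⟩ := hP.nonempty U hU
        exact hP.eq_of_mem U hU _ h x hx (hP.subset U hU hx)
      · rintro rfl
        exact h
    · rintro rfl
      refine ⟨⟨?_, ?_, ?_, ?_, ?_⟩, by simp⟩ <;> simp +contextual [hpq]
  rw [ncSumBlock, this]
  simp

theorem catalan_eq_factorial_div (k : ℕ) :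
    (catalan k : ℂ) = ((2 * k).factorial : ℂ) / (k.factorial * (k + 1).factorial) := by
  have h1 : ((k : ℂ) + 1) * catalan k = k.centralBinom := by
    exact_mod_cast succ_mul_catalan_eq_centralBinom k
  have h2 : (k.centralBinom : ℂ) * (k.factorial * k.factorial) = (2 * k).factorial := by
    have := Nat.choose_mul_factorial_mul_factorial (show k ≤ 2 * k by omega)
    rw [show 2 * k - k = k by omega] at this
    rw [Nat.centralBinom_eq_two_mul_choose]
    exact_mod_cast (by rw [← mul_assoc]; exact this)
  rw [eq_div_iff (mul_ne_zero (Nat.cast_ne_zero.2 (Nat.factorial_ne_zero _))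
    (Nat.cast_ne_zero.2 (Nat.factorial_ne_zero _))), Nat.factorial_succ, ← h2, ← h1]
  push_cast
  ring

theorem IsSemicircular.moment_two_mul {s : A} (hs : IsSemicircular φ s) (k : ℕ) :
    φ (s ^ (2 * k)) = catalan k := by
  rw [hs, if_pos (by simp), catalan_eq_factorial_div]
  simp

theorem IsSemicircular.moment_odd {s : A} (hs : IsSemicircular φ s) {k : ℕ} (hk : ¬ Even k) :
    φ (s ^ k) = 0 := by
  rw [hs, if_neg hk]

/-- The even moments are the Catalan numbers, so for even `r` this is the Catalan recursion with
vanishing odd terms inserted. For odd `r` every product contains an odd moment. -/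
theorem IsSemicircular.moment_add_two {s : A} (hs : IsSemicircular φ s) (r : ℕ) :
    φ (s ^ (r + 2)) = ∑ i ∈ range (r + 1), φ (s ^ i) * φ (s ^ (r - i)) := by
  by_cases hr : Even r
  · obtain ⟨k, rfl⟩ := hr.two_dvd
    rw [show 2 * k + 2 = 2 * (k + 1) by ring, hs.moment_two_mul, catalan_succ',
      Finset.Nat.sum_antidiagonal_eq_sum_range_succ (fun i j => catalan i * catalan j)]
    push_cast
    rw [← sum_filter_of_ne (p := Even) (s := range (2 * k + 1))]
    · refine sum_bij (fun i _ => 2 * i) ?_ ?_ ?_ ?_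
      · intro i hi
        simp only [mem_filter, mem_range] at hi ⊢
        exact ⟨by omega, by simp⟩
      · intro i _ j _ h
        omega
      · intro i hi
        simp only [mem_filter, mem_range] at hi
        obtain ⟨j, rfl⟩ := hi.2.two_dvd
        exact ⟨j, by simp only [mem_range]; omega, rfl⟩
      · intro i _
        rw [← Nat.mul_sub, hs.moment_two_mul, hs.moment_two_mul]
    · intro i _ h
      by_contra hi
      exact h (by rw [hs.moment_odd hi, zero_mul])
  · rw [hs.moment_odd (by simpa [Nat.even_add] using hr), sum_eq_zero]
    intro i hi
    rw [mem_range] at hi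
    by_cases h : Even i
    · rw [hs.moment_odd (k := r - i), mul_zero]
      rw [Nat.even_sub (by omega)]
      tauto
    · rw [hs.moment_odd h, zero_mul]

theorem mom_const (s : A) (p q : ℕ) : mom φ (fun _ => s) (Ico p q) = φ (s ^ (q - p)) := by
  rw [mom, letters_const, List.prod_replicate, Nat.card_Ico]

/-- The only non-vanishing free cumulant of a semicircular variable is the second one. -/
theorem IsSemicircular.listCumulant_replicate (hφ : φ 1 = 1) {s : A} (hs : IsSemicircular φ s)
    (r : ℕ) (hr : 0 < r) : listCumulant φ (List.replicate r s) = if r = 2 then 1 else 0 := by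
  induction r using Nat.strong_induction_on with
  | _ r ih =>
  have h1 := ncSum_eq_sum_block (cum φ fun _ => s) (fun _ => 1) hr
  rw [← mom_Ico_eq_ncSum φ hφ _ hr.le, mom_const, Nat.sub_zero] at h1
  have hmem : Ico 0 r ∈ (Ico 0 r).powerset.filter (0 ∈ ·) := by simp [hr]
  have hcum : ∀ V, cum φ (fun _ => s) V = listCumulant φ (List.replicate V.card s) := by
    intro V
    rw [cum, letters_const]
  -- The smaller cumulants are known by induction; only the full block carries the unknown `r`-th
  -- cumulant. The vacuous condition fits the shape of `sum_pair_blocks`.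
  have hlt : ∀ V ∈ ((Ico 0 r).powerset.filter (0 ∈ ·)).erase (Ico 0 r),
      cum φ (fun _ => s) V = if V.card = 2 ∧ ∀ i ∈ V, True then 1 else 0 := by
    intro V hV
    simp only [mem_erase, mem_filter, mem_powerset] at hV
    have hc := card_lt_card (hV.2.1.ssubset_of_ne hV.1)
    rw [Nat.card_Ico, Nat.sub_zero] at hc
    rw [hcum, ih _ hc (card_pos.2 ⟨0, hV.2.2⟩)]
    simp
  rw [← add_sum_erase _ _ hmem, ncSumBlock_full _ hr, mul_one, hcum, Nat.card_Ico,
    Nat.sub_zero, sum_congr rfl fun V hV => by rw [hlt V hV]] at h1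
  by_cases h2 : r = 2
  · rw [sum_eq_zero, add_zero] at h1
    · rw [← h1, h2, hs.moment_two_mul 1]
      simp
    · intro V hV
      simp only [mem_erase, mem_filter, mem_powerset] at hV
      have hc := card_lt_card (hV.2.1.ssubset_of_ne hV.1)
      rw [Nat.card_Ico, Nat.sub_zero] at hc
      rw [if_neg (by omega), zero_mul]
  -- For `r ≠ 2` the full block is not a pair, so its term is zero and can be put back. By the
  -- moment recursion the pair blocks already give all of `φ (s ^ r)`, and the `r`-th cumulant must
  -- vanish.
  · rw [sum_erase _ (by simp [h2]), sum_pair_blocks hφ (fun _ => s) (fun _ => True) trivial] at h1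
    simp only [h2, if_false]
    simp only [mom_const, filter_true] at h1
    rcases (show r = 1 ∨ 2 ≤ r by omega) with rfl | hr2
    · rw [hs.moment_odd (by simp)] at h1
      rw [show Ioo 0 1 = (∅ : Finset ℕ) from rfl] at h1
      simpa using h1.symm
    · obtain ⟨m, rfl⟩ := Nat.exists_eq_add_of_le' hr2
      rw [hs.moment_add_two] at h1
      have h3 : ∑ j ∈ Ioo 0 (m + 2), φ (s ^ (j - (0 + 1))) * φ (s ^ (m + 2 - (j + 1))) =
          ∑ i ∈ range (m + 1), φ (s ^ i) * φ (s ^ (m - i)) := by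
        symm
        refine sum_bij (fun i _ => i + 1) ?_ ?_ ?_ ?_
        · intro i hi
          simp only [mem_range, mem_Ioo] at hi ⊢
          omega
        · intro i _ j _ h
          omega
        · intro i hi
          simp only [mem_Ioo] at hi
          exact ⟨i - 1, by simp only [mem_range]; omega, by omega⟩
        · intro i _
          rw [show i + 1 - (0 + 1) = i by omega, show m + 2 - (i + 1 + 1) = m - i by omega]
      rw [h3] at h1
      simpa using h1

/-- The recursion for moments starting with a semicircular variable, for tuples. -/
theorem mom_semicircular {ι : Type*} {S : ι → Set A} (hfree : AreFree φ S) (hφ : φ 1 = 1) {s : A}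
    (hs : IsSemicircular φ s) {c₀ : ι} (hc₀ : S c₀ = {s}) {p q : ℕ} (hpq : p < q) (x : ℕ → A)
    (c : ℕ → ι) [DecidablePred fun j => c j = c₀]
    (hx : ∀ i ∈ Ico p q, x i ∈ S (c i)) (hp : c p = c₀) :
    mom φ x (Ico p q) =
      ∑ j ∈ Ioo p q with c j = c₀, mom φ x (Ico (p + 1) j) * mom φ x (Ico (j + 1) q) := by
  rw [mom_Ico_eq_ncSum φ hφ x hpq.le, ncSum_eq_sum_block _ _ hpq,
    ← sum_pair_blocks hφ x (fun j => c j = c₀) hp]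
  refine sum_congr rfl fun V hV => ?_
  congr 1
  simp only [mem_filter, mem_powerset] at hV
  -- The block of `p` either consists of copies of `s`, where only pairs count, or is mixed, since
  -- it contains `p`, and is killed by freeness.
  by_cases hall : ∀ i ∈ V, c i = c₀
  · have hl : letters x V = List.replicate V.card s := by
      rw [← letters_const]
      refine letters_congr fun i hi => ?_
      have := hx i (hV.1 hi)
      rw [hall i hi, hc₀] at this
      simpa using this
    rw [cum, hl, hs.listCumulant_replicate hφ _ (card_pos.2 ⟨p, hV.2⟩)]
    exact if_congr (and_iff_left hall).symm rfl rfl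
  · rw [if_neg fun h => hall h.2]
    obtain ⟨i, hi, hci⟩ : ∃ i ∈ V, c i ≠ c₀ := by simpa using hall
    have hlen : (letters x V).length = (V.sort (· ≤ ·)).length := by simp [letters]
    have hget : ∀ m : Fin (letters x V).length,
        (letters x V).get m = x ((V.sort (· ≤ ·)).get (Fin.cast hlen m)) := by
      intro m
      rw [List.get_eq_getElem, List.get_eq_getElem]
      simp only [letters, List.getElem_map]
      rfl
    have hidx : ∀ i ∈ V, ∃ m : Fin (letters x V).length,
        (V.sort (· ≤ ·)).get (Fin.cast hlen m) = i := by
      intro i hi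
      obtain ⟨m, hm⟩ := List.get_of_mem ((Finset.mem_sort (· ≤ ·)).2 hi)
      exact ⟨Fin.cast hlen.symm m, by simpa using hm⟩
    refine hfree _ _ (fun m => c ((V.sort (· ≤ ·)).get (Fin.cast hlen m))) ?_ ?_
    · intro m
      rw [hget]
      exact hx _ (hV.1 ((Finset.mem_sort (· ≤ ·)).1 (List.get_mem _ _)))
    · obtain ⟨m, hm⟩ := hidx i hi
      obtain ⟨m', hm'⟩ := hidx p hV.2
      exact ⟨m, m', by simp only [hm, hm', hp]; exact hci⟩

end Cumulants

section Splitting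

variable (φ : A →ₗ[ℂ] ℂ) (s : A)

/-- The sum of `φ(u v₁) φ(v₂)` over the decompositions `W = v₁ s v₂`. -/
def splitSum : A → List (Option A) → ℂ
  | _, [] => 0
  | u, none :: W => φ u * φ (wprod s W) + splitSum (u * s) W
  | u, some y :: W => splitSum (u * y) W

open Classical in
theorem splitSum_eq_sum (u : A) (W : List (Option A)) :
    splitSum φ s u W = ∑ j ∈ range W.length, if W[j]? = some none then
      φ (u * wprod s (W.take j)) * φ (wprod s (W.drop (j + 1))) else 0 := by
  induction W generalizing u with
  | nil => simp [splitSum]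
  | cons a W ih =>
    rw [List.length_cons, sum_range_succ']
    cases a with
    | none =>
      rw [add_comm]
      simp [splitSum, ih, mul_assoc]
    | some y => simp [splitSum, ih, mul_assoc]

variable {φ s}

theorem splitSum_letters {ι : Type*} {S : ι → Set A} (hfree : AreFree φ S) (hφ : φ 1 = 1)
    (hs : IsSemicircular φ s) {c₀ : ι} (hc₀ : S c₀ = {s}) (W : List (Option A))
    (hW : ∀ y, some y ∈ W → ∃ c, c ≠ c₀ ∧ y ∈ S c) :
    φ (s * wprod s W) = splitSum φ s 1 W := by
  classical
  -- The colour records the formal letter and not the element: some `y` may equal `s` in `A`, but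
  -- `some y` must not be paired. The clause `a ≠ none` sends `none` to `c₀`.
  let col : Option A → ι := fun a =>
    if h : ∃ c, c ≠ c₀ ∧ a.getD s ∈ S c ∧ a ≠ none then h.choose else c₀
  have hcol : ∀ a ∈ none :: W, a.getD s ∈ S (col a) ∧ (col a = c₀ ↔ a = none) := by
    rintro (_ | y) ha
    · simp [col, hc₀]
    · have h : ∃ c, c ≠ c₀ ∧ (some y).getD s ∈ S c ∧ some y ≠ none := by
        obtain ⟨c, h1, h2⟩ := hW y (by simpa using ha)
        exact ⟨c, h1, h2, by simp⟩
      have h' : col (some y) = h.choose := dif_pos h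
      rw [h']
      exact ⟨h.choose_spec.2.1, iff_of_false h.choose_spec.1 (by simp)⟩
  set l : List A := (none :: W).map fun a => a.getD s with hl
  have hlen : l.length = W.length + 1 := by simp [hl]
  let c : ℕ → ι := fun i => col ((none :: W).getD i none)
  have key := mom_semicircular hfree hφ hs hc₀ (p := 0) (q := W.length + 1) (by omega)
    (fun i => l.getD i 0) c ?_ (by simp [c, (hcol none (by simp)).2])
  · rw [mom, letters_Ico_getD _ hlen.ge, Nat.sub_zero, List.drop_zero, ← hlen,
      List.take_length] at key
    have h0 : φ (s * wprod s W) = φ l.prod := by simp [hl, wprod]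
    rw [h0, key, splitSum_eq_sum, sum_filter]
    symm
    refine sum_bij (fun i _ => i + 1) ?_ ?_ ?_ ?_
    · intro i hi
      simp only [mem_range, mem_Ioo] at hi ⊢
      omega
    · intro i _ j _ h
      omega
    · intro i hi
      simp only [mem_Ioo] at hi
      exact ⟨i - 1, by simp only [mem_range]; omega, by omega⟩
    · intro i hi
      rw [mem_range] at hi
      have h1 : (W[i]? = some none) ↔ c (i + 1) = c₀ := by
        have hget : (none :: W).getD (i + 1) none = W[i] := by simp [hi]
        simp only [c, hget]
        rw [(hcol W[i] (by simp)).2, List.getElem?_eq_getElem hi]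
        simp
      simp only [h1]
      congr 1
      rw [mom, mom, letters_Ico_getD _ (by omega), letters_Ico_getD _ le_rfl]
      have h2 : l = s :: W.map fun a => a.getD s := by simp [hl]
      have h3 : (List.drop (i + 1) (W.map fun a => a.getD s)).take (W.length - (i + 1)) =
          List.drop (i + 1) (W.map fun a => a.getD s) := List.take_of_length_le (by simp)
      rw [h2]
      simp [wprod, List.map_take, List.map_drop, h3]
  · intro i hi
    rw [mem_Ico] at hi
    have h1 : (none :: W).getD i none = (none :: W)[i]'(by simp; omega) := by
      rw [List.getD_eq_getElem?_getD, List.getElem?_eq_getElem (by simp; omega)]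
      rfl
    have h2 : l.getD i 0 = ((none :: W).getD i none).getD s := by
      rw [h1, List.getD_eq_getElem?_getD, List.getElem?_eq_getElem (by omega)]
      simp only [hl, Option.getD_some, List.getElem_map]
    rw [h2]
    exact (hcol _ (by rw [h1]; exact List.getElem_mem _)).1

theorem splitSum_map_some_append (u : A) (l : List A) (W : List (Option A)) :
    splitSum φ s u (l.map some ++ W) = splitSum φ s (u * l.prod) W := by
  induction l generalizing u with
  | nil => simp
  | cons y l ih => simp [splitSum, ih, mul_assoc]

/-- The recursion `φ(s w) = ∑ φ(w₁) φ(w₂)`, summed over `w = w₁ s w₂`, for words in `s` and elements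
of `M`. -/
def SemicircularOver (φ : A →ₗ[ℂ] ℂ) (s : A) (M : Submonoid A) : Prop :=
  ∀ W : List (Option A), (∀ y, some y ∈ W → y ∈ M) → φ (s * wprod s W) = splitSum φ s 1 W

/-- Writing a letter of the submonoid as a product of generators changes neither the word nor the
places where it can be split. Letters such as `d n * d 0` and products of the `b i` thereby become
admissible. -/
theorem semicircularOver_closure {ι : Type*} {S : ι → Set A} (hfree : AreFree φ S) (hφ : φ 1 = 1)
    (hs : IsSemicircular φ s) {c₀ : ι} (hc₀ : S c₀ = {s}) :
    SemicircularOver φ s (Submonoid.closure {y | ∃ c, c ≠ c₀ ∧ y ∈ S c}) := by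
  intro W hW
  obtain ⟨W', h1, h2, h3⟩ : ∃ W' : List (Option A), (∀ y, some y ∈ W' → ∃ c, c ≠ c₀ ∧ y ∈ S c) ∧
      wprod s W' = wprod s W ∧ ∀ u, splitSum φ s u W' = splitSum φ s u W := by
    induction W with
    | nil => exact ⟨[], by simp, rfl, fun _ => rfl⟩
    | cons a W ih =>
      obtain ⟨W', h1, h2, h3⟩ := ih fun y hy => hW y (by simp [hy])
      cases a with
      | none =>
        exact ⟨none :: W', by simpa using h1, by simp [h2], fun u => by simp [splitSum, h2, h3]⟩
      | some y =>
        obtain ⟨l, hl, rfl⟩ := Submonoid.exists_list_of_mem_closure (hW y (by simp))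
        refine ⟨l.map some ++ W', ?_, ?_, fun u => ?_⟩
        · intro y hy
          simp only [List.mem_append, List.mem_map, Option.some.injEq, exists_eq_right] at hy
          rcases hy with hy | hy
          · exact hl y hy
          · exact h1 y hy
        · have : wprod s (l.map some) = l.prod := by simp [wprod, Function.comp_def]
          simp [h2, this]
        · rw [splitSum_map_some_append, h3]
          rfl
  rw [← h2, splitSum_letters hfree hφ hs hc₀ W' h1, h3]

end Splitting

end

/-! ### Moments of alternating words. -/

section

/-- Subsets of `[p, q)` containing `p`, sorted by their second element. -/
theorem sum_powerset_Ico (F : Finset ℕ → ℂ) {p q : ℕ} (hpq : p < q) :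
    ∑ V ∈ (Ico p q).powerset with p ∈ V, F V =
      F {p} + ∑ k ∈ Ico (p + 1) q, ∑ V ∈ (Ico k q).powerset with k ∈ V, F (insert p V) := by
  have hmem : {p} ∈ (Ico p q).powerset.filter (p ∈ ·) := by simp [hpq]
  rw [← add_sum_erase _ _ hmem, sum_sigma']
  congr 1
  symm
  refine sum_bij (fun a _ => insert p a.2) ?_ ?_ ?_ ?_
  · rintro ⟨k, V⟩ h
    simp only [mem_sigma, mem_filter, mem_powerset, mem_Ico] at h
    obtain ⟨hk, hV, hkV⟩ := h
    simp only [mem_erase, mem_filter, mem_powerset]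
    refine ⟨fun e => ?_, ?_, by simp⟩
    · have : k ∈ ({p} : Finset ℕ) := e ▸ mem_insert_of_mem hkV
      rw [mem_singleton] at this
      omega
    · intro i hi
      rw [mem_Ico]
      rcases mem_insert.1 hi with rfl | hi
      · omega
      · have := mem_Ico.1 (hV hi)
        omega
  · rintro ⟨k, V⟩ h ⟨k', V'⟩ h' e
    simp only [mem_sigma, mem_filter, mem_powerset, mem_Ico] at h h' e
    obtain ⟨hk, hV, hkV⟩ := h
    obtain ⟨hk', hV', hkV'⟩ := h'
    have h1 : ∀ i, p < i → (i ∈ V ↔ i ∈ V') := by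
      intro i hi
      have : i ∈ insert p V ↔ i ∈ insert p V' := by rw [e]
      simpa [hi.ne'] using this
    have h2 : V = V' := by
      ext i
      by_cases hi : p < i
      · exact h1 i hi
      · exact iff_of_false (fun h => by have := mem_Ico.1 (hV h); omega)
          (fun h => by have := mem_Ico.1 (hV' h); omega)
    subst h2
    have := mem_Ico.1 (hV hkV')
    have := mem_Ico.1 (hV' hkV)
    obtain rfl : k = k' := by omega
    rfl
  · intro V hV
    simp only [mem_erase, mem_filter, mem_powerset] at hV
    obtain ⟨hne, hV, hp⟩ := hV
    have hnonempty : (V.erase p).Nonempty := by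
      rw [nonempty_iff_ne_empty]
      intro h
      exact hne (by rw [← insert_erase hp, h]; rfl)
    have hk := min'_mem _ hnonempty
    refine ⟨⟨(V.erase p).min' hnonempty, V.erase p⟩, ?_, insert_erase hp⟩
    have h1 := mem_Ico.1 (hV (mem_of_mem_erase hk))
    have h2 := ne_of_mem_erase hk
    simp only [mem_sigma, mem_filter, mem_powerset]
    refine ⟨mem_Ico.2 (by omega), fun i hi => mem_Ico.2 ⟨min'_le _ _ hi, ?_⟩, hk⟩
    exact (mem_Ico.1 (hV (mem_of_mem_erase hi))).2
  · intro _ _; rfl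

section Word

section WordTail

variable {A : Type*} (b d : ℕ → A)

/-- The word `s b_k s d_k ⋯ s b_l s d_l`. -/
def wordTail (k l : ℕ) : List (Option A) :=
  (List.range' k (l + 1 - k)).flatMap fun i => [none, some (b i), none, some (d i)]

theorem wordTail_self (l : ℕ) : wordTail b d (l + 1) l = [] := by simp [wordTail]

theorem wordTail_eq_cons {k l : ℕ} (h : k ≤ l) :
    wordTail b d k l = none :: some (b k) :: none :: some (d k) :: wordTail b d (k + 1) l := by
  rw [wordTail, show l + 1 - k = (l + 1 - (k + 1)) + 1 by omega, List.range'_succ]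
  simp [wordTail]

theorem mem_wordTail {k l : ℕ} {y : A} (h : some y ∈ wordTail b d k l) :
    ∃ i, k ≤ i ∧ i ≤ l ∧ (y = b i ∨ y = d i) := by
  simp only [wordTail, List.mem_flatMap, List.mem_range'_1] at h
  obtain ⟨i, hi, h⟩ := h
  refine ⟨i, hi.1, by omega, ?_⟩
  simpa using h

theorem count_wordTail {k l : ℕ} : Even ((wordTail b d k l).countP (·.isNone)) := by
  rw [wordTail]
  induction List.range' k (l + 1 - k) with
  | nil => simp
  | cons i L ih =>
    rw [List.flatMap_cons, List.countP_append]
    exact Even.add (by simp) ih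

end WordTail

variable {A : Type*} [Ring A] (s : A) (b d : ℕ → A)

theorem word_self (k : ℕ) : word s b d k k = d k := by simp [word]

theorem word_succ {k l : ℕ} (h : k ≤ l) :
    word s b d k (l + 1) = word s b d k l * (s * b (l + 1) * s * d (l + 1)) := by
  rw [word, word, show l + 1 - k = (l - k) + 1 by omega, List.range'_concat]
  rw [List.map_append, List.prod_append, mul_assoc]
  simp [show k + 1 + (l - k) = l + 1 by omega]

theorem word_eq_cons {k l : ℕ} (h : k < l) :
    word s b d k l = d k * (s * b (k + 1) * s * word s b d (k + 1) l) := by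
  rw [word, word, show l - k = (l - (k + 1)) + 1 by omega, List.range'_succ]
  simp [mul_assoc]

variable {s b d}

theorem word_congr {b' d' : ℕ → A} {k l : ℕ} (h : k ≤ l) (hb : ∀ i, k < i → i ≤ l → b i = b' i)
    (hd : ∀ i, k ≤ i → i ≤ l → d i = d' i) : word s b d k l = word s b' d' k l := by
  rw [word, word, hd k le_rfl h]
  congr 2
  refine List.map_congr_left fun i hi => ?_
  rw [List.mem_range'_1] at hi
  rw [hb i (by omega) (by omega), hd i (by omega) (by omega)]

variable (s b d)

theorem word_update_last (e : A) {k l : ℕ} (h : k ≤ l) :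
    word s b (Function.update d l (d l * e)) k l = word s b d k l * e := by
  rcases h.eq_or_lt with rfl | h
  · simp [word_self]
  · obtain ⟨m, rfl⟩ := Nat.exists_eq_add_of_lt h
    rw [word_succ _ _ _ (by omega), word_succ _ _ _ (by omega), Function.update_self,
      word_congr (b := b) (b' := b) (d' := d) (by omega) (fun _ _ _ => rfl)]
    · simp only [mul_assoc]
    · intro i _ hi
      rw [Function.update_of_ne (by omega)]

theorem wprod_wordTail {k l : ℕ} (h : k ≤ l) :
    d k * wprod s (wordTail b d (k + 1) l) = word s b d k l := by
  induction h using Nat.decreasingInduction with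
  | self => simp [wordTail_self, word_self]
  | of_succ k hk ih =>
    rw [wordTail_eq_cons _ _ hk, word_eq_cons _ _ _ hk, ← ih]
    simp [mul_assoc]

end Word

variable {A : Type*} [Ring A] [Algebra ℂ A] {φ : A →ₗ[ℂ] ℂ} {s : A} {M : Submonoid A}

/-- Taking one `s` out of an even number leaves an odd number, so in every splitting one of the two
factors has an odd number of letters `s`, and fewer than `N`. -/
theorem splitSum_eq_zero {N : ℕ}
    (ih : ∀ W : List (Option A), (∀ y, some y ∈ W → y ∈ M) → Odd (W.countP (·.isNone)) →
      W.countP (·.isNone) < N → φ (wprod s W) = 0)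
    (U W : List (Option A)) (hU : ∀ y, some y ∈ U → y ∈ M) (hW : ∀ y, some y ∈ W → y ∈ M)
    (hN : U.countP (·.isNone) + W.countP (·.isNone) ≤ N)
    (hodd : Even (U.countP (·.isNone) + W.countP (·.isNone))) :
    splitSum φ s (wprod s U) W = 0 := by
  induction W generalizing U with
  | nil => rfl
  | cons a W ihW =>
    have hW' : ∀ y, some y ∈ W → y ∈ M := fun y hy => hW y (by simp [hy])
    cases a with
    | none =>
      simp only [List.countP_cons, Option.isNone_none, if_true] at hN hodd
      have h1 := ihW (U ++ [none]) (by simpa using hU) hW'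
        (by simp [List.countP_append]; omega)
        (by simp only [List.countP_append, List.countP_cons, List.countP_nil, Option.isNone_none,
              if_true]; convert hodd using 1; omega)
      simp only [wprod_append, wprod_none, wprod_nil, mul_one] at h1
      rw [splitSum, h1, add_zero]
      rcases Nat.even_or_odd (U.countP (·.isNone)) with h | h
      · have : Odd (W.countP (·.isNone)) := by
          rw [Nat.odd_iff]
          rw [Nat.even_iff] at h hodd
          omega
        rw [ih W hW' this (by omega), mul_zero]
      · rw [ih U hU h (by omega), zero_mul]
    | some y =>
      have h1 := ihW (U ++ [some y]) (by
          intro z hz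
          simp only [List.mem_append, List.mem_singleton, Option.some.injEq] at hz
          rcases hz with hz | rfl
          · exact hU z hz
          · exact hW z (by simp)) hW'
        (by simpa [List.countP_append, List.countP_cons] using hN)
        (by simpa [List.countP_append, List.countP_cons] using hodd)
      simpa [splitSum] using h1

/-- A word with an odd number of letters `s` has vanishing moment. -/
theorem SemicircularOver.eq_zero_of_odd (hS : SemicircularOver φ s M)
    (hφ : ∀ x y : A, φ (x * y) = φ (y * x)) (W : List (Option A)) (hW : ∀ y, some y ∈ W → y ∈ M)
    (hodd : Odd (W.countP (·.isNone))) : φ (wprod s W) = 0 := by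
  induction hN : W.countP (·.isNone) using Nat.strong_induction_on generalizing W with
  | _ N ih =>
  have hmem : none ∈ W := by
    have h0 := hodd.pos
    rw [List.countP_pos_iff] at h0
    obtain ⟨a, ha, h⟩ := h0
    rw [Option.isNone_iff_eq_none] at h
    rwa [h] at ha
  obtain ⟨U, T, rfl⟩ := List.append_of_mem hmem
  -- The trace rotates the word until it begins with an `s`, as the recursion requires.
  have e : φ (wprod s (U ++ none :: T)) = φ (s * wprod s (T ++ U)) := by
    rw [wprod_append, hφ, wprod_none, wprod_append, mul_assoc]
  have hTU : ∀ y, some y ∈ T ++ U → y ∈ M := by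
    intro y hy
    refine hW y ?_
    simp only [List.mem_append, List.mem_cons] at hy ⊢
    tauto
  simp only [List.countP_append, List.countP_cons, Option.isNone_none, if_true] at hN hodd
  rw [e, hS _ hTU]
  refine splitSum_eq_zero (U := []) (N := N) (M := M) (fun W hW hodd hlt => ih _ hlt W hW hodd rfl)
    _ (by simp) hTU ?_ ?_
  · simp only [List.countP_append, List.countP_nil]
    omega
  · rw [Nat.even_iff]
    rw [Nat.odd_iff] at hodd
    simp only [List.countP_append, List.countP_nil]
    omega

/-- Only the splittings at an `s` directly after some `d i` survive; before an `s` that follows some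
`b i` the prefix contains an odd number of letters `s`. -/
theorem SemicircularOver.splitSum_word (hS : SemicircularOver φ s M)
    (hφ : ∀ x y : A, φ (x * y) = φ (y * x)) {b d : ℕ → A} {p l : ℕ}
    (hb : ∀ i, p ≤ i → i ≤ l → b i ∈ M) (hd : ∀ i, p ≤ i → i ≤ l → d i ∈ M) (B : A)
    {m : ℕ} (hpm : p ≤ m) (hml : m ≤ l) :
    splitSum φ s (word s b d p m) (wordTail b d (m + 1) l ++ [none, some B]) =
      ∑ k ∈ Ico (m + 1) (l + 1), φ (word s b d p (k - 1)) *
        φ (B * b k * (s * word s b d k l * s)) + φ (word s b d p l) * φ B := by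
  induction hml using Nat.decreasingInduction with
  | self => simp [wordTail_self, splitSum]
  | of_succ m hm ih =>
    rw [wordTail_eq_cons _ _ hm, sum_eq_sum_Ico_succ_bot (by omega)]
    simp only [List.cons_append, splitSum]
    have hodd : φ (word s b d p m * s * b (m + 1)) = 0 := by
      have h1 := hS.eq_zero_of_odd hφ
        (some (d p) :: (wordTail b d (p + 1) m ++ [none, some (b (m + 1))])) ?_ ?_
      · simpa [← mul_assoc, wprod_wordTail s b d hpm] using h1
      · intro y hy
        simp only [List.mem_cons, List.mem_append, Option.some.injEq, List.not_mem_nil, or_false,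
          reduceCtorEq, false_or] at hy
        rcases hy with rfl | hy | rfl
        · exact hd p le_rfl (by omega)
        · obtain ⟨i, h1, h2, rfl | rfl⟩ := mem_wordTail b d hy
          · exact hb i (by omega) (by omega)
          · exact hd i (by omega) (by omega)
        · exact hb _ (by omega) (by omega)
      · have := count_wordTail b d (k := p + 1) (l := m)
        rw [Nat.even_iff] at this
        rw [Nat.odd_iff]
        simp only [List.countP_cons, List.countP_append, List.countP_nil, Option.isNone_none,
          Option.isNone_some, if_true, Bool.false_eq_true, if_false]
        omega
    have e1 : word s b d p m * s * b (m + 1) * s * d (m + 1) = word s b d p (m + 1) := by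
      rw [word_succ _ _ _ hpm]
      simp only [mul_assoc]
    rw [hodd, zero_mul, zero_add, e1, ih (by omega), ← add_assoc, Nat.add_sub_cancel]
    congr 3
    rw [mul_assoc B, hφ B, ← wprod_wordTail s b d hm]
    simp [mul_assoc]

/-- The expansion of `φ(B s w s)` along the block of the first letter, for an alternating
word `w`. -/
theorem SemicircularOver.word_expansion (hS : SemicircularOver φ s M)
    (hφ : ∀ x y : A, φ (x * y) = φ (y * x)) {b d : ℕ → A} {f g : Finset ℕ → ℂ} {p l : ℕ}
    (hpl : p ≤ l)
    (hb : ∀ i, p ≤ i → i ≤ l → b i ∈ M) (hd : ∀ i, p ≤ i → i ≤ l → d i ∈ M)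
    (hZ : ∀ i j, p ≤ i → i ≤ j → j ≤ l → ncSumBlock f g {i} i (j + 1) = φ (word s b d i j))
    (B : A) (hB : B ∈ M) :
    φ (B * (s * word s b d p l * s)) = ∑ V ∈ (Ico p (l + 1)).powerset with p ∈ V,
      φ (B * (letters b (V.erase p)).prod) * ncSumBlock f g V p (l + 1) := by
  induction hN : l - p using Nat.strong_induction_on generalizing p B with
  | _ N ih =>
  -- Rotated by the trace, `B` stands at the end and the word begins with the `s` that is to be
  -- paired.
  have h1 := hS (some (d p) :: (wordTail b d (p + 1) l ++ [none, some B])) ?_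
  · have h2 : s * wprod s (some (d p) :: (wordTail b d (p + 1) l ++ [none, some B])) =
        s * word s b d p l * s * B := by
      rw [wprod_some, wprod_append, ← wprod_wordTail s b d hpl]
      simp [mul_assoc]
    have h3 := hS.splitSum_word hφ hb hd B le_rfl hpl
    rw [word_self] at h3
    rw [hφ, ← h2, h1, splitSum, one_mul, h3, sum_powerset_Ico _ (by omega), add_comm]
    congr 1
    · simp [hZ p l le_rfl hpl le_rfl, mul_comm]
    · refine sum_congr rfl fun k hk => ?_
      rw [mem_Ico] at hk
      -- The second element `k` of the block adds its letter `b k` to `B`; the rest of the block is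
      -- treated as a block with first point `k`.
      rw [ih (l - k) (by omega) (by omega) (fun i hi => hb i (by omega))
        (fun i hi => hd i (by omega)) (fun i j hi => hZ i j (by omega)) (B * b k)
        (M.mul_mem hB (hb k (by omega) (by omega))) rfl, mul_sum]
      refine sum_congr rfl fun V hV => ?_
      simp only [mem_filter, mem_powerset] at hV
      have hpV : p ∉ V := fun h => by have := mem_Ico.1 (hV.1 h); omega
      have hk1 : k - 1 + 1 = k := by omega
      have hZk := hZ p (k - 1) le_rfl (by omega) (by omega)
      rw [hk1] at hZk
      rw [ncSumBlock_insert f g (by omega) hV.1 hV.2, hZk, erase_insert hpV]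
      have h4 : letters b V = b k :: letters b (V.erase k) := by
        conv_lhs => rw [← insert_erase hV.2]
        refine letters_insert_min b fun y hy => ?_
        have := mem_Ico.1 (hV.1 (mem_of_mem_erase hy))
        have := ne_of_mem_erase hy
        omega
      rw [h4, List.prod_cons, mul_assoc B]
      ring
  · intro y hy
    simp only [List.mem_cons, List.mem_append, Option.some.injEq, List.not_mem_nil, or_false,
      reduceCtorEq, false_or] at hy
    rcases hy with rfl | hy | rfl
    · exact hd p le_rfl (by omega)
    · obtain ⟨i, h1, h2, rfl | rfl⟩ := mem_wordTail b d hy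
      · exact hb i (by omega) (by omega)
      · exact hd i (by omega) (by omega)
    · exact hB

/-- `hZ` remains a hypothesis because `ncSumBlock_eq_word`, which supplies it, uses this lemma on a
shorter interval within its own induction. -/
theorem ncSum_eq_of_word_expansion (hS : SemicircularOver φ s M)
    (hφ : ∀ x y : A, φ (x * y) = φ (y * x)) {b d : ℕ → A} {p l : ℕ} (hpl : p ≤ l)
    (hb : ∀ i, p ≤ i → i ≤ l → b i ∈ M) (hd : ∀ i, p ≤ i → i ≤ l → d i ∈ M)
    (hZ : ∀ i j, p ≤ i → i ≤ j → j ≤ l →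
      ncSumBlock (mom φ b) (mom φ d) {i} i (j + 1) = φ (word s b d i j)) :
    ncSum (mom φ b) (mom φ d) p (l + 1) = φ (b p * (s * word s b d p l * s)) := by
  rw [hS.word_expansion hφ hpl hb hd hZ (b p) (hb p le_rfl hpl), ncSum_eq_sum_block _ _ (by omega)]
  refine sum_congr rfl fun V hV => ?_
  simp only [mem_filter, mem_powerset] at hV
  congr 1
  rw [mom, ← List.prod_cons, ← letters_insert_min, insert_erase hV.2]
  intro y hy
  have := mem_Ico.1 (hV.1 (mem_of_mem_erase hy))
  have := ne_of_mem_erase hy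
  omega

/-- The moment of an alternating word as a sum over non-crossing partitions with first point a
singleton. -/
theorem ncSumBlock_eq_word (hS : SemicircularOver φ s M)
    (hφ : ∀ x y : A, φ (x * y) = φ (y * x)) {b d : ℕ → A} {p l : ℕ} (hpl : p ≤ l)
    (hb : ∀ i, p ≤ i → i ≤ l → b i ∈ M) (hd : ∀ i, p ≤ i → i ≤ l → d i ∈ M) :
    ncSumBlock (mom φ b) (mom φ d) {p} p (l + 1) = φ (word s b d p l) := by
  -- `d` has to vary: deleting the singleton `p` changes the last letter to `d l * d p`.
  induction hN : l - p using Nat.strong_induction_on generalizing p l d with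
  | _ N ih =>
  rcases hpl.eq_or_lt with rfl | hlt
  · rw [ncSumBlock_singleton_succ, word_self]
    simp [mom]
  · rw [ncSumBlock_singleton φ hφ _ _ (by omega), Nat.add_sub_cancel]
    have hd' : ∀ i, p + 1 ≤ i → i ≤ l → Function.update d l (d l * d p) i ∈ M := by
      intro i hi hil
      rw [Function.update_apply]
      split_ifs
      · exact M.mul_mem (hd l hpl le_rfl) (hd p le_rfl hpl)
      · exact hd i (by omega) hil
    rw [ncSum_eq_of_word_expansion hS hφ hlt (fun i hi => hb i (by omega)) hd',
      word_update_last _ _ _ _ hlt, word_eq_cons _ _ _ hlt, hφ (d p)]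
    · rw [hφ (s * b (p + 1) * s * _), hφ (b (p + 1)), hφ (d p), hφ (s * _ * s)]
      have e : s * b (p + 1) * s * word s b d (p + 1) l * d p =
          s * (b (p + 1) * s * word s b d (p + 1) l * d p) := by simp only [mul_assoc]
      rw [e, hφ s]
      simp only [mul_assoc]
    · intro i j hi hij hjl
      exact ih (j - i) (by omega) hij (fun a ha ha' => hb a (by omega) (by omega))
        (fun a ha ha' => hd' a (by omega) (by omega)) rfl

theorem ncSum_eq_word (hS : SemicircularOver φ s M)
    (hφ : ∀ x y : A, φ (x * y) = φ (y * x)) {b d : ℕ → A} {p l : ℕ} (hpl : p ≤ l)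
    (hb : ∀ i, p ≤ i → i ≤ l → b i ∈ M) (hd : ∀ i, p ≤ i → i ≤ l → d i ∈ M) :
    ncSum (mom φ b) (mom φ d) p (l + 1) = φ (b p * (s * word s b d p l * s)) :=
  ncSum_eq_of_word_expansion hS hφ hpl hb hd fun _ _ hi hij hj =>
    ncSumBlock_eq_word hS hφ hij (fun a ha _ => hb a (by omega) (by omega))
      fun a ha _ => hd a (by omega) (by omega)

end

/-! ### Fattening: non-crossing partitions and non-crossing pairings. -/

section

section Next

/-- `j` is the cyclic successor of `i` in `U`. -/
def IsNext (U : Finset ℕ) (i j : ℕ) : Prop :=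
  j ∈ U ∧ ((i < j ∧ ∀ k ∈ U, k ≤ i ∨ j ≤ k) ∨ ∀ k ∈ U, j ≤ k ∧ k ≤ i)

variable {U : Finset ℕ} {i j : ℕ}

theorem exists_isNext (hi : i ∈ U) : ∃ j, IsNext U i j := by
  by_cases h : (U.filter (i < ·)).Nonempty
  · have hm := min'_mem _ h
    rw [mem_filter] at hm
    refine ⟨_, hm.1, Or.inl ⟨hm.2, fun k hk => ?_⟩⟩
    by_cases hik : i < k
    · exact Or.inr (min'_le _ _ (mem_filter.2 ⟨hk, hik⟩))
    · exact Or.inl (not_lt.1 hik)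
  · refine ⟨U.min' ⟨i, hi⟩, min'_mem _ _, Or.inr fun k hk => ⟨min'_le _ _ hk, ?_⟩⟩
    by_contra hik
    exact h ⟨k, mem_filter.2 ⟨hk, not_le.1 hik⟩⟩

theorem exists_isNext_of_mem (hj : j ∈ U) : ∃ i ∈ U, IsNext U i j := by
  by_cases h : (U.filter (· < j)).Nonempty
  · have hm := max'_mem _ h
    rw [mem_filter] at hm
    refine ⟨_, hm.1, hj, Or.inl ⟨hm.2, fun k hk => ?_⟩⟩
    by_cases hkj : k < j
    · exact Or.inl (le_max' _ _ (mem_filter.2 ⟨hk, hkj⟩))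
    · exact Or.inr (not_lt.1 hkj)
  · refine ⟨U.max' ⟨j, hj⟩, max'_mem _ _, hj, Or.inr fun k hk => ⟨?_, le_max' _ _ hk⟩⟩
    by_contra hkj
    exact h ⟨k, mem_filter.2 ⟨hk, not_le.1 hkj⟩⟩

theorem IsNext.unique {j' : ℕ} (h : IsNext U i j) (h' : IsNext U i j') : j = j' := by
  obtain ⟨hj, h⟩ := h
  obtain ⟨hj', h'⟩ := h'
  rcases h with ⟨h1, h⟩ | h <;> rcases h' with ⟨h1', h'⟩ | h'
  · have := h j' hj'
    have := h' j hj
    omega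
  · have := h' j hj
    omega
  · have := h j' hj'
    omega
  · have := h j' hj'
    have := h' j hj
    omega

theorem IsNext.injective {i' : ℕ} (hi : i ∈ U) (hi' : i' ∈ U) (h : IsNext U i j)
    (h' : IsNext U i' j) : i = i' := by
  obtain ⟨hj, h⟩ := h
  obtain ⟨-, h'⟩ := h'
  rcases h with ⟨h1, h⟩ | h <;> rcases h' with ⟨h1', h'⟩ | h'
  · have := h i' hi'
    have := h' i hi
    omega
  · have := h' i hi
    omega
  · have := h i' hi'
    omega
  · have := h i' hi'
    have := h' i hi
    omega

/-- Induction along cyclic successors. -/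
theorem IsNext.induction {S : ℕ → Prop} (hi : i ∈ U) (hS : S i)
    (h : ∀ a c, a ∈ U → S a → IsNext U a c → S c) (k : ℕ) (hk : k ∈ U) : S k := by
  have up : ∀ a ∈ U, S a → ∀ c ∈ U, a ≤ c → S c := by
    intro a ha hSa c
    induction c using Nat.strong_induction_on with
    | _ c ih =>
    intro hc hac
    rcases hac.eq_or_lt with rfl | hac
    · exact hSa
    · obtain ⟨e, he, hec⟩ := exists_isNext_of_mem hc
      rcases hec.2 with ⟨h1, h2⟩ | h1
      · have := h2 a ha
        exact h e c he (ih e h1 he (by omega)) hec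
      · have := h1 a ha
        omega
  have hmax := max'_mem U ⟨i, hi⟩
  have hmin := min'_mem U ⟨i, hi⟩
  -- Climb from `i` to the maximum, step around to the minimum, and climb from there to `k`.
  refine up _ hmin (h _ _ hmax (up i hi hS _ hmax (le_max' _ _ hi)) ?_) k hk (min'_le _ _ hk)
  exact ⟨hmin, Or.inr fun k hk => ⟨min'_le _ _ hk, le_max' _ _ hk⟩⟩

end Next

open Classical in
/-- The pairing that joins `2 i + 1` to `2 j`, where `j` is the cyclic successor of `i` in its
block. -/
def fatten (P : Finset (Finset ℕ)) : Finset (Finset ℕ) :=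
  P.biUnion fun U => ((U ×ˢ U).filter fun a => IsNext U a.1 a.2).image fun a => {2 * a.1 + 1, 2 * a.2}

theorem mem_fatten {P : Finset (Finset ℕ)} {X : Finset ℕ} :
    X ∈ fatten P ↔ ∃ U ∈ P, ∃ i ∈ U, ∃ j, IsNext U i j ∧ X = {2 * i + 1, 2 * j} := by
  simp only [fatten, mem_biUnion, mem_image, mem_filter, mem_product, Prod.exists]
  constructor
  · rintro ⟨U, hU, i, j, ⟨⟨hi, hj⟩, h⟩, rfl⟩
    exact ⟨U, hU, i, hi, j, h, rfl⟩
  · rintro ⟨U, hU, i, hi, j, h, rfl⟩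
    exact ⟨U, hU, i, j, ⟨⟨hi, h.1⟩, h⟩, rfl⟩

theorem pair_injective {i j i' j' : ℕ}
    (h : ({2 * i + 1, 2 * j} : Finset ℕ) = {2 * i' + 1, 2 * j'}) : i = i' ∧ j = j' := by
  have h1 : 2 * i + 1 ∈ ({2 * i' + 1, 2 * j'} : Finset ℕ) := h ▸ by simp
  have h2 : 2 * j ∈ ({2 * i' + 1, 2 * j'} : Finset ℕ) := h ▸ by simp
  rw [mem_insert, mem_singleton] at h1 h2
  omega

theorem pair_mem_fatten {P : Finset (Finset ℕ)} {i j : ℕ} :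
    {2 * i + 1, 2 * j} ∈ fatten P ↔ ∃ U ∈ P, i ∈ U ∧ IsNext U i j := by
  rw [mem_fatten]
  constructor
  · rintro ⟨U, hU, i', hi, j', h, e⟩
    obtain ⟨rfl, rfl⟩ := pair_injective e
    exact ⟨U, hU, hi, h⟩
  · rintro ⟨U, hU, hi, h⟩
    exact ⟨U, hU, i, hi, j, h, rfl⟩

section Fatten

variable {p q : ℕ} {P : Finset (Finset ℕ)}

/-- These are the four ways in which the pairs `{2 i + 1, 2 j}` and `{2 i' + 1, 2 j'}` can cross;
weak inequalities come from comparing an even point with an odd one. Each forces `U = W`, and then a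
point of the block lies where cyclic succession allows none. -/
theorem not_cross_next {U W : Finset ℕ} (hP : IsNCPart (Ico p q) P) (hU : U ∈ P) (hW : W ∈ P)
    {i j i' j' : ℕ} (hi : i ∈ U) (hj : IsNext U i j) (hi' : i' ∈ W) (hj' : IsNext W i' j') :
    ¬ (i < j ∧ i < i' ∧ i' < j ∧ j < j') ∧ ¬ (i < j ∧ i < j' ∧ j' < j ∧ j ≤ i') ∧
    ¬ (j ≤ i ∧ j ≤ i' ∧ i' < i ∧ i < j') ∧ ¬ (j ≤ i ∧ j < j' ∧ j' ≤ i ∧ i < i') := by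
  obtain ⟨hjU, h⟩ := hj
  obtain ⟨hjW, h'⟩ := hj'
  refine ⟨?_, ?_, ?_, ?_⟩
  · rintro ⟨h1, h2, h3, h4⟩
    obtain rfl := hP.noncross U hU W hW i i' j j' h2 h3 h4 hi hjU hi' hjW
    rcases h with h | h
    · have := h.2 i' hi'; omega
    · have := h i hi; have := h j hjU; omega
  · rintro ⟨h1, h2, h3, h4⟩
    have e : U = W := by
      rcases h4.eq_or_lt with h4 | h4
      · exact hP.eq_of_mem U hU W hW j hjU (h4 ▸ hi')
      · exact hP.noncross U hU W hW i j' j i' h2 h3 h4 hi hjU hjW hi'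
    subst e
    rcases h with h | h
    · have := h.2 j' hjW; omega
    · have := h i hi; have := h j hjU; omega
  · rintro ⟨h1, h2, h3, h4⟩
    have e : U = W := by
      rcases h2.eq_or_lt with h2 | h2
      · exact hP.eq_of_mem U hU W hW j hjU (h2 ▸ hi')
      · exact hP.noncross U hU W hW j i' i j' h2 h3 h4 hjU hi hi' hjW
    subst e
    rcases h with h | h
    · omega
    · have := h j' hjW; omega
  · rintro ⟨h1, h2, h3, h4⟩
    have e : U = W := by
      rcases h3.eq_or_lt with h3 | h3
      · exact hP.eq_of_mem U hU W hW i hi (h3 ▸ hjW)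
      · exact hP.noncross U hU W hW j j' i i' h2 h3 h4 hjU hi hjW hi'
    subst e
    rcases h with h | h
    · omega
    · have := h i' hi'; omega

theorem fatten_isNCPart (hP : IsNCPart (Ico p q) P) :
    IsNCPart (Ico (2 * p) (2 * q)) (fatten P) := by
  have hPm : ∀ U ∈ P, ∀ x ∈ U, p ≤ x ∧ x < q := fun U hU x hx => mem_Ico.1 (hP.subset U hU hx)
  refine ⟨?_, ?_, ?_, ?_, ?_⟩
  · intro X hX
    obtain ⟨U, hU, i, hi, j, h, rfl⟩ := mem_fatten.1 hX
    simp
  · intro X hX x hx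
    obtain ⟨U, hU, i, hi, j, h, rfl⟩ := mem_fatten.1 hX
    have := hPm U hU i hi
    have := hPm U hU j h.1
    rw [mem_insert, mem_singleton] at hx
    rw [mem_Ico]
    omega
  · intro x hx
    rw [mem_Ico] at hx
    obtain ⟨U, hU, hxU⟩ := hP.cover (x / 2) (mem_Ico.2 (by omega))
    rcases Nat.even_or_odd' x with ⟨i, rfl | rfl⟩
    · rw [show 2 * i / 2 = i by omega] at hxU
      obtain ⟨j, hj, h⟩ := exists_isNext_of_mem hxU
      exact ⟨_, pair_mem_fatten.2 ⟨U, hU, hj, h⟩, by simp⟩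
    · rw [show (2 * i + 1) / 2 = i by omega] at hxU
      obtain ⟨j, h⟩ := exists_isNext hxU
      exact ⟨_, pair_mem_fatten.2 ⟨U, hU, hxU, h⟩, by simp⟩
  · intro X hX Y hY x hxX hxY
    obtain ⟨U, hU, i, hi, j, h, rfl⟩ := mem_fatten.1 hX
    obtain ⟨W, hW, i', hi', j', h', rfl⟩ := mem_fatten.1 hY
    rw [mem_insert, mem_singleton] at hxX hxY
    rcases hxX with rfl | rfl <;> rcases hxY with e | e
    · obtain rfl : i = i' := by omega
      obtain rfl := hP.eq_of_mem U hU W hW i hi hi'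
      rw [h.unique h']
    · omega
    · omega
    · obtain rfl : j = j' := by omega
      obtain rfl := hP.eq_of_mem U hU W hW j h.1 h'.1
      rw [h.injective hi hi' h']
  · intro X hX Y hY a b c e hab hbc hce ha hc hb he
    obtain ⟨U, hU, i, hi, j, h, rfl⟩ := mem_fatten.1 hX
    obtain ⟨W, hW, i', hi', j', h', rfl⟩ := mem_fatten.1 hY
    rw [mem_insert, mem_singleton] at ha hb hc he
    have := not_cross_next hP hU hW hi h hi' h'
    omega

theorem card_of_mem_fatten {X : Finset ℕ} (hX : X ∈ fatten P) : X.card = 2 := by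
  obtain ⟨U, hU, i, hi, j, h, rfl⟩ := mem_fatten.1 hX
  exact card_pair (by omega)

theorem slotRel_fatten {a c : ℕ} : SlotRel (fatten P) a c ↔ ∀ U ∈ P, ∀ i ∈ U, ∀ j, IsNext U i j →
    ((2 * i + 1 ≤ a ↔ 2 * i + 1 ≤ c) ↔ (2 * j ≤ a ↔ 2 * j ≤ c)) := by
  constructor
  · intro h U hU i hi j hj
    exact h _ (pair_mem_fatten.2 ⟨U, hU, hi, hj⟩) _ (by simp) _ (by simp)
  · intro h X hX x hx y hy
    obtain ⟨U, hU, i, hi, j, hj, rfl⟩ := mem_fatten.1 hX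
    have := h U hU i hi j hj
    rw [mem_insert, mem_singleton] at hx hy
    rcases hx with rfl | rfl <;> rcases hy with rfl | rfl
    · rfl
    · exact this
    · exact this.symm
    · rfl

/-- An odd slot never comes between `2 k` and `2 k + 1`. Hence not separating any pair means not
separating cyclic neighbours in a block, and so not separating the block. -/
theorem slotRel_fatten_odd {i j : ℕ} :
    SlotRel (fatten P) (2 * i + 1) (2 * j + 1) ↔ SlotRel P i j := by
  rw [slotRel_fatten]
  constructor
  · intro h U hU x hx y hy
    refine IsNext.induction (S := fun y => (x ≤ i ↔ x ≤ j) ↔ (y ≤ i ↔ y ≤ j)) hx Iff.rfl ?_ y hy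
    intro a c ha hS hac
    have := h U hU a ha c hac
    have e1 : ∀ m, 2 * a + 1 ≤ 2 * m + 1 ↔ a ≤ m := by omega
    have e2 : ∀ m, 2 * c ≤ 2 * m + 1 ↔ c ≤ m := by omega
    rw [e1, e1, e2, e2] at this
    exact hS.trans this
  · intro h U hU a ha c hac
    have := h U hU a ha c hac.1
    have e1 : ∀ m, 2 * a + 1 ≤ 2 * m + 1 ↔ a ≤ m := by omega
    have e2 : ∀ m, 2 * c ≤ 2 * m + 1 ↔ c ≤ m := by omega
    rw [e1, e1, e2, e2]
    exact this

/-- The slot `2 i` lies between `2 i` and `2 i + 1`. Follow the pairs around `U` from `2 i + 1` back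
to `2 i`: if `j ∉ U`, the side of the chord never changes, although the chord separates these two
end points. -/
theorem mem_of_slotRel_fatten {U : Finset ℕ} (hU : U ∈ P) {i j : ℕ} (hij : i < j) (hi : i ∈ U)
    (h : SlotRel (fatten P) (2 * i) (2 * j)) : j ∈ U := by
  rw [slotRel_fatten] at h
  by_contra hj
  have key : ∀ k ∈ U, i ≤ k ∧ k < j := by
    refine IsNext.induction (S := fun k => i ≤ k ∧ k < j) hi ⟨le_rfl, hij⟩ ?_
    intro a c ha hS hac
    have := h U hU a ha c hac
    have hcj : c ≠ j := fun e => hj (e ▸ hac.1)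
    omega
  obtain ⟨x, hx, hxi⟩ := exists_isNext_of_mem hi
  have := key x hx
  have := h U hU x hx i hxi
  omega

theorem slotRel_fatten_of_mem (hP : IsNCPart (Ico p q) P) {U : Finset ℕ} (hU : U ∈ P) {i j : ℕ}
    (hi : i ∈ U) (hj : j ∈ U) (hij : i < j) : SlotRel (fatten P) (2 * i) (2 * j) := by
  rw [slotRel_fatten]
  intro W hW x hx y hy
  by_cases hUW : W = U
  · subst hUW
    rcases hy.2 with ⟨h1, h2⟩ | h1
    · have := h2 i hi
      have := h2 j hj
      omega
    · have := h1 i hi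
      have := h1 j hj
      omega
  · have hd : ∀ z ∈ W, z ≠ i ∧ z ≠ j := by
      intro z hz
      constructor
      · rintro rfl
        exact hUW (hP.eq_of_mem W hW U hU z hz hi)
      · rintro rfl
        exact hUW (hP.eq_of_mem W hW U hU z hz hj)
    have hx1 := hd x hx
    have hy1 := hd y hy.1
    have n1 : ∀ z ∈ W, ∀ w ∈ W, ¬ (i < z ∧ z < j ∧ j < w) := fun z hz w hw h =>
      hUW (hP.noncross U hU W hW i z j w h.1 h.2.1 h.2.2 hi hj hz hw).symm
    have n2 : ∀ z ∈ W, ∀ w ∈ W, ¬ (z < i ∧ i < w ∧ w < j) := fun z hz w hw h =>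
      hUW (hP.noncross W hW U hU z i w j h.1 h.2.1 h.2.2 hz hw hi hj)
    have := n1 x hx y hy.1
    have := n1 y hy.1 x hx
    have := n2 x hx y hy.1
    have := n2 y hy.1 x hx
    omega

theorem slotRel_fatten_even (hP : IsNCPart (Ico p q) P) {U : Finset ℕ} (hU : U ∈ P) {i j : ℕ}
    (hi : i ∈ U) (hj : p ≤ j ∧ j < q) : SlotRel (fatten P) (2 * i) (2 * j) ↔ j ∈ U := by
  constructor
  · intro h
    rcases lt_trichotomy i j with hij | rfl | hij
    · exact mem_of_slotRel_fatten hU hij hi h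
    · exact hi
    · obtain ⟨W, hW, hjW⟩ := hP.cover j (mem_Ico.2 hj)
      have := mem_of_slotRel_fatten hW hij hjW h.symm
      rwa [hP.eq_of_mem U hU W hW i hi this]
  · intro h
    rcases lt_trichotomy i j with hij | rfl | hij
    · exact slotRel_fatten_of_mem hP hU hi h hij
    · exact SlotRel.refl _ _
    · exact (slotRel_fatten_of_mem hP hU h hi hij).symm

/-- The chord splits the couple `2 i`, `2 i + 1` and no other couple `2 k`, `2 k + 1`, so the walk
around the block of `i` would change sides exactly once. -/
theorem not_slotRel_fatten (hP : IsNCPart (Ico p q) P) {i : ℕ} (j : ℕ) (hi : p ≤ i ∧ i < q) :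
    ¬ SlotRel (fatten P) (2 * i) (2 * j + 1) := by
  rw [slotRel_fatten]
  intro h
  obtain ⟨U, hU, hiU⟩ := hP.cover i (mem_Ico.2 hi)
  obtain ⟨x, hx, hxi⟩ := exists_isNext_of_mem hiU
  have hx' := h U hU x hx i hxi
  by_cases hij : i ≤ j
  · have key : ∀ k ∈ U, i ≤ k ∧ k ≤ j := by
      refine IsNext.induction (S := fun k => i ≤ k ∧ k ≤ j) hiU ⟨le_rfl, hij⟩ ?_
      intro a c ha hS hac
      have := h U hU a ha c hac
      omega
    have := key x hx
    omega
  · have key : ∀ k ∈ U, ¬ (j < k ∧ k < i) := by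
      refine IsNext.induction (S := fun k => ¬ (j < k ∧ k < i)) hiU (by omega) ?_
      intro a c ha hS hac
      have := h U hU a ha c hac
      omega
    have := key x hx
    omega

theorem slotClass_fatten_even (hP : IsNCPart (Ico p q) P) {U : Finset ℕ} (hU : U ∈ P) {i : ℕ}
    (hi : i ∈ U) : slotClass (2 * p) (2 * q) (fatten P) (2 * i) = U.image (2 * ·) := by
  have him := mem_Ico.1 (hP.subset U hU hi)
  ext x
  rw [mem_slotClass, mem_image]
  constructor
  · rintro ⟨hx, h⟩
    rcases Nat.even_or_odd' x with ⟨j, rfl | rfl⟩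
    · exact ⟨j, (slotRel_fatten_even hP hU hi (by omega)).1 h, rfl⟩
    · exact (not_slotRel_fatten hP j him h).elim
  · rintro ⟨j, hj, rfl⟩
    have := mem_Ico.1 (hP.subset U hU hj)
    exact ⟨by omega, (slotRel_fatten_even hP hU hi (by omega)).2 hj⟩

theorem slotClass_fatten_odd (hP : IsNCPart (Ico p q) P) (i : ℕ) :
    slotClass (2 * p) (2 * q) (fatten P) (2 * i + 1) =
      (slotClass p q P i).image (2 * · + 1) := by
  ext x
  simp only [mem_slotClass, mem_image]
  constructor
  · rintro ⟨hx, h⟩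
    rcases Nat.even_or_odd' x with ⟨j, rfl | rfl⟩
    · exact (not_slotRel_fatten hP i (by omega) h.symm).elim
    · exact ⟨j, ⟨by omega, slotRel_fatten_odd.1 h⟩, rfl⟩
  · rintro ⟨j, ⟨hj, h⟩, rfl⟩
    exact ⟨by omega, slotRel_fatten_odd.2 h⟩

theorem kr_fatten (hP : IsNCPart (Ico p q) P) : kr (2 * p) (2 * q) (fatten P) =
    P.image (image (2 * ·)) ∪ (kr p q P).image (image (2 * · + 1)) := by
  ext W
  simp only [mem_union, mem_kr, mem_image]
  constructor
  · rintro ⟨x, hx, rfl⟩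
    rcases Nat.even_or_odd' x with ⟨i, rfl | rfl⟩
    · obtain ⟨U, hU, hi⟩ := hP.cover i (mem_Ico.2 (by omega))
      exact Or.inl ⟨U, hU, (slotClass_fatten_even hP hU hi).symm⟩
    · exact Or.inr ⟨_, ⟨i, by omega, rfl⟩, (slotClass_fatten_odd hP i).symm⟩
  · rintro (⟨U, hU, rfl⟩ | ⟨_, ⟨i, hi, rfl⟩, rfl⟩)
    · obtain ⟨i, hi⟩ := hP.nonempty U hU
      have := mem_Ico.1 (hP.subset U hU hi)
      exact ⟨2 * i, by omega, slotClass_fatten_even hP hU hi⟩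
    · exact ⟨2 * i + 1, by omega, slotClass_fatten_odd hP i⟩

theorem prod_kr_fatten (hP : IsNCPart (Ico p q) P) (f : Finset ℕ → ℂ) :
    ∏ W ∈ kr (2 * p) (2 * q) (fatten P), f W =
      (∏ U ∈ P, f (U.image (2 * ·))) * ∏ W ∈ kr p q P, f (W.image (2 * · + 1)) := by
  have h1 : Function.Injective (fun i : ℕ => 2 * i) := fun i j h => by
    simp only at h; omega
  have h2 : Function.Injective (fun i : ℕ => 2 * i + 1) := fun i j h => by
    simp only at h; omega
  rw [kr_fatten hP, prod_union, prod_image ((image_injective h1).injOn),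
    prod_image ((image_injective h2).injOn)]
  rw [Finset.disjoint_left]
  intro X hX hX'
  obtain ⟨U, hU, rfl⟩ := mem_image.1 hX
  obtain ⟨W, -, e⟩ := mem_image.1 hX'
  obtain ⟨i, hi⟩ := hP.nonempty U hU
  have : 2 * i ∈ W.image (2 * · + 1) := e ▸ mem_image_of_mem _ hi
  obtain ⟨j, -, h⟩ := mem_image.1 this
  omega

/-- The blocks of `P` can be read off from the classes of the even slots of `fatten P`. -/
theorem fatten_injOn (p q : ℕ) : Set.InjOn fatten (ncp p q : Set (Finset (Finset ℕ))) := by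
  have key : ∀ P P' : Finset (Finset ℕ), IsNCPart (Ico p q) P → IsNCPart (Ico p q) P' →
      fatten P = fatten P' → P ⊆ P' := by
    intro P P' hP hP' h U hU
    obtain ⟨i, hi⟩ := hP.nonempty U hU
    obtain ⟨W, hW, hiW⟩ := hP'.cover i (hP.subset U hU hi)
    have e := slotClass_fatten_even hP hU hi
    rw [h, slotClass_fatten_even hP' hW hiW] at e
    have h1 : Function.Injective (fun i : ℕ => 2 * i) := fun i j h => by
      simp only at h; omega
    rwa [← image_injective h1 e]
  intro P hP P' hP' h
  have hP := mem_ncp.1 (mem_coe.1 hP)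
  have hP' := mem_ncp.1 (mem_coe.1 hP')
  exact (key P P' hP hP' h).antisymm (key P' P hP' hP h.symm)

end Fatten

section Pairing

variable {p q : ℕ} {Q : Finset (Finset ℕ)}

/-- By non-crossing, the points strictly between `x` and `y` are paired among themselves, so their
number is even. -/
theorem odd_sub_of_pair (hQ : IsNCPart (Ico p q) Q) (h2 : ∀ X ∈ Q, X.card = 2) {x y : ℕ}
    (hxy : x < y) (h : {x, y} ∈ Q) : Odd (y - x) := by
  have hx := mem_Ico.1 (hQ.subset _ h (show x ∈ {x, y} by simp))
  have hy := mem_Ico.1 (hQ.subset _ h (show y ∈ {x, y} by simp))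
  have e : Ioo x y = (Q.filter (· ⊆ Ioo x y)).biUnion id := by
    ext z
    simp only [mem_biUnion, mem_filter, id]
    constructor
    · intro hz
      have hz' := mem_Ioo.1 hz
      obtain ⟨X, hX, hzX⟩ := hQ.cover z (mem_Ico.2 (by omega))
      refine ⟨X, ⟨hX, fun w hw => ?_⟩, hzX⟩
      have hne : X ≠ {x, y} := by
        rintro rfl
        rw [mem_insert, mem_singleton] at hzX
        omega
      have hwx : w ≠ x := fun e => hne (hQ.eq_of_mem X hX _ h w hw (by simp [e]))
      have hwy : w ≠ y := fun e => hne (hQ.eq_of_mem X hX _ h w hw (by simp [e]))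
      rw [mem_Ioo]
      by_contra hcon
      rcases (show w < x ∨ y < w by omega) with hw' | hw'
      · exact hne (hQ.noncross X hX _ h w x z y hw' hz'.1 hz'.2 hw hzX (by simp) (by simp))
      · exact hne (hQ.noncross _ h X hX x z y w hz'.1 hz'.2 hw' (by simp) (by simp) hzX hw).symm
    · rintro ⟨X, ⟨-, hX⟩, hz⟩
      exact hX hz
  have hc : (Ioo x y).card = 2 * (Q.filter (· ⊆ Ioo x y)).card := by
    conv_lhs => rw [e]
    rw [card_biUnion]
    · rw [sum_congr rfl (fun X hX => show (id X).card = 2 from h2 X (mem_filter.1 hX).1), sum_const, smul_eq_mul, mul_comm]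
    · intro X hX Y hY hne
      refine Finset.disjoint_left.2 fun z hz hz' => ?_
      exact hne (hQ.eq_of_mem X (mem_filter.1 (mem_coe.1 hX)).1 Y
        (mem_filter.1 (mem_coe.1 hY)).1 z hz hz')
  rw [Nat.card_Ioo] at hc
  rw [Nat.odd_iff]
  omega

open Classical in
/-- The class of `i` when the slots after the points `2 i` are identified along `Q`. -/
def evenClass (p q : ℕ) (Q : Finset (Finset ℕ)) (i : ℕ) : Finset ℕ :=
  {j ∈ Ico p q | SlotRel Q (2 * i) (2 * j)}

theorem mem_evenClass {i j : ℕ} :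
    j ∈ evenClass p q Q i ↔ (p ≤ j ∧ j < q) ∧ SlotRel Q (2 * i) (2 * j) := by
  simp [evenClass]

theorem evenClass_congr {i j : ℕ} (h : SlotRel Q (2 * i) (2 * j)) :
    evenClass p q Q i = evenClass p q Q j := by
  ext k
  simp only [mem_evenClass]
  exact and_congr_right fun _ => ⟨fun h' => h.symm.trans h', fun h' => h.trans h'⟩

/-- Two crossing chords cut the points into four arcs. A block separated by neither lies in a single
arc, and the chord from `i` to `j` does not separate it either. -/
theorem SlotRel.of_cross {i j k l : ℕ} (hij : i < j) (hjk : j < k) (hkl : k < l)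
    (h : SlotRel Q i k) (h' : SlotRel Q j l) : SlotRel Q i j := by
  intro U hU x hx y hy
  have h1 := h U hU x hx y hy
  have h2 := h' U hU x hx y hy
  omega

theorem image_evenClass_isNCPart (p q : ℕ) (Q : Finset (Finset ℕ)) :
    IsNCPart (Ico p q) ((Ico p q).image (evenClass p q Q)) := by
  refine ⟨?_, ?_, ?_, ?_, ?_⟩
  · intro U hU
    obtain ⟨i, hi, rfl⟩ := mem_image.1 hU
    exact ⟨i, mem_evenClass.2 ⟨mem_Ico.1 hi, SlotRel.refl _ _⟩⟩
  · intro U hU x hx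
    obtain ⟨i, hi, rfl⟩ := mem_image.1 hU
    exact mem_Ico.2 (mem_evenClass.1 hx).1
  · intro x hx
    exact ⟨_, mem_image_of_mem _ hx, mem_evenClass.2 ⟨mem_Ico.1 hx, SlotRel.refl _ _⟩⟩
  · intro U hU W hW x hx hx'
    obtain ⟨i, hi, rfl⟩ := mem_image.1 hU
    obtain ⟨j, hj, rfl⟩ := mem_image.1 hW
    exact evenClass_congr ((mem_evenClass.1 hx).2.trans (mem_evenClass.1 hx').2.symm)
  · intro U hU W hW a b c e hab hbc hce ha hc hb he
    obtain ⟨i, hi, rfl⟩ := mem_image.1 hU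
    obtain ⟨j, hj, rfl⟩ := mem_image.1 hW
    have h1 := (mem_evenClass.1 ha).2
    have h2 := (mem_evenClass.1 hc).2
    have h3 := (mem_evenClass.1 hb).2
    have h4 := (mem_evenClass.1 he).2
    refine evenClass_congr (h1.trans (SlotRel.trans ?_ h3.symm))
    exact SlotRel.of_cross (by omega) (by omega) (by omega) (h1.symm.trans h2) (h3.symm.trans h4)

/-- The chord from slot `2 i` to slot `2 j` runs alongside the pair, so a block it separates would
cross the pair. Conversely the pair excludes slots of the class between `i` and `j`. -/
theorem isNext_evenClass (hQ : IsNCPart (Ico (2 * p) (2 * q)) Q) {i j : ℕ}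
    (h : {2 * i + 1, 2 * j} ∈ Q) : IsNext (evenClass p q Q i) i j := by
  have hj := mem_Ico.1 (hQ.subset _ h (show 2 * j ∈ _ by simp))
  have hrel : SlotRel Q (2 * i) (2 * j) := by
    intro W hW x hx y hy
    by_cases hne : W = {2 * i + 1, 2 * j}
    · subst hne
      rw [mem_insert, mem_singleton] at hx hy
      omega
    · have hd : ∀ z ∈ W, z ≠ 2 * i + 1 ∧ z ≠ 2 * j := by
        intro z hz
        constructor <;> rintro rfl <;> exact hne (hQ.eq_of_mem W hW _ h _ hz (by simp))
      have n1 : ∀ u ∈ ({2 * i + 1, 2 * j} : Finset ℕ), ∀ v ∈ ({2 * i + 1, 2 * j} : Finset ℕ),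
          ∀ z ∈ W, ∀ w ∈ W, ¬ (u < z ∧ z < v ∧ v < w) := fun u hu v hv z hz w hw hh =>
        hne (hQ.noncross _ h W hW u z v w hh.1 hh.2.1 hh.2.2 hu hv hz hw).symm
      have n2 : ∀ u ∈ ({2 * i + 1, 2 * j} : Finset ℕ), ∀ v ∈ ({2 * i + 1, 2 * j} : Finset ℕ),
          ∀ z ∈ W, ∀ w ∈ W, ¬ (z < u ∧ u < w ∧ w < v) := fun u hu v hv z hz w hw hh =>
        hne (hQ.noncross W hW _ h z u w v hh.1 hh.2.1 hh.2.2 hz hw hu hv)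
      have m1 : 2 * i + 1 ∈ ({2 * i + 1, 2 * j} : Finset ℕ) := by simp
      have m2 : 2 * j ∈ ({2 * i + 1, 2 * j} : Finset ℕ) := by simp
      have := hd x hx
      have := hd y hy
      have := n1 _ m1 _ m2 x hx y hy
      have := n1 _ m1 _ m2 y hy x hx
      have := n1 _ m2 _ m1 x hx y hy
      have := n1 _ m2 _ m1 y hy x hx
      have := n2 _ m1 _ m2 x hx y hy
      have := n2 _ m1 _ m2 y hy x hx
      have := n2 _ m2 _ m1 x hx y hy
      have := n2 _ m2 _ m1 y hy x hx
      omega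
  refine ⟨mem_evenClass.2 ⟨by omega, hrel⟩, ?_⟩
  have hk : ∀ k ∈ evenClass p q Q i,
      ((2 * i + 1 ≤ 2 * i ↔ 2 * i + 1 ≤ 2 * k) ↔ (2 * j ≤ 2 * i ↔ 2 * j ≤ 2 * k)) :=
    fun k hk => (mem_evenClass.1 hk).2 _ h _ (by simp) _ (by simp)
  by_cases hij : i < j
  · left
    refine ⟨hij, fun k hkm => ?_⟩
    have := hk k hkm
    omega
  · right
    intro k hkm
    have := hk k hkm
    omega

/-- The even slot classes are the only possible blocks of a preimage. Every pair joins an odd point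
to an even one and reappears after fattening; two partitions of one set, one contained in the other,
are equal. -/
theorem exists_fatten_eq (hQ : IsNCPart (Ico (2 * p) (2 * q)) Q) (h2 : ∀ X ∈ Q, X.card = 2) :
    ∃ P, IsNCPart (Ico p q) P ∧ fatten P = Q := by
  have hP := image_evenClass_isNCPart p q Q
  refine ⟨_, hP, ?_⟩
  have hsub : Q ⊆ fatten ((Ico p q).image (evenClass p q Q)) := by
    intro X hX
    obtain ⟨i, j, rfl⟩ : ∃ i j, X = {2 * i + 1, 2 * j} := by
      obtain ⟨x, y, hxy, rfl⟩ := card_eq_two.1 (h2 X hX)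
      have hodd : Odd (y - x) ∨ Odd (x - y) := by
        rcases lt_or_gt_of_ne hxy with h | h
        · exact Or.inl (odd_sub_of_pair hQ h2 h hX)
        · exact Or.inr (odd_sub_of_pair hQ h2 h (by rwa [pair_comm]))
      simp only [Nat.odd_iff] at hodd
      rcases Nat.even_or_odd' x with ⟨i, rfl | rfl⟩
      · exact ⟨y / 2, i, by rw [pair_comm, show 2 * (y / 2) + 1 = y by omega]⟩
      · exact ⟨i, y / 2, by rw [show 2 * (y / 2) = y by omega]⟩
    have hi := mem_Ico.1 (hQ.subset _ hX (show 2 * i + 1 ∈ _ by simp))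
    have him : i ∈ Ico p q := mem_Ico.2 (by omega)
    exact pair_mem_fatten.2 ⟨_, mem_image_of_mem _ him,
      mem_evenClass.2 ⟨mem_Ico.1 him, SlotRel.refl _ _⟩, isNext_evenClass hQ hX⟩
  refine Finset.Subset.antisymm ?_ hsub
  intro X hX
  have hF := fatten_isNCPart hP
  obtain ⟨x, hx⟩ := hF.nonempty X hX
  obtain ⟨Y, hY, hxY⟩ := hQ.cover x (hF.subset X hX hx)
  rwa [hF.eq_of_mem X hX Y (hsub hY) x hx hxY]

/-- Non-crossing pairings of `[2 p, 2 q)` correspond to non-crossing partitions of `[p, q)`. -/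
theorem sum_pairings (p q : ℕ) (C : Finset (Finset ℕ) → Prop) [DecidablePred C]
    (F : Finset (Finset ℕ) → ℂ) :
    ∑ R ∈ ncp (2 * p) (2 * q) with (∀ X ∈ R, X.card = 2) ∧ C R, F R =
      ∑ P ∈ ncp p q with C (fatten P), F (fatten P) := by
  symm
  refine sum_nbij fatten ?_ ?_ ?_ ?_
  · intro P hP
    simp only [mem_filter, mem_ncp] at hP ⊢
    exact ⟨fatten_isNCPart hP.1, fun X hX => card_of_mem_fatten hX, hP.2⟩
  · exact (fatten_injOn p q).mono (coe_subset.2 (filter_subset _ _))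
  · intro R hR
    rw [mem_coe, mem_filter, mem_ncp] at hR
    obtain ⟨P, hP, rfl⟩ := exists_fatten_eq hR.1 hR.2.1
    exact ⟨P, mem_coe.2 (mem_filter.2 ⟨mem_ncp.2 hP, hR.2.2⟩), rfl⟩
  · intro _ _; rfl

end Pairing

end

/-! ### Chains of pairs, and the passage from interval sums to the stated sums. -/

variable {A : Type*} [Ring A]

section Chain

theorem lt_of_chain {t : ℕ} {k : ℕ → ℕ} (hk : ∀ i < t, k i < k (i + 1)) {i j : ℕ} (hij : i < j)
    (hj : j ≤ t) : k i < k j := by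
  induction j with
  | zero => omega
  | succ j ih =>
    have := hk j (by omega)
    rcases (show i = j ∨ i < j by omega) with rfl | h
    · exact this
    · exact (ih h (by omega)).trans this

theorem isNext_chain {t : ℕ} {k : ℕ → ℕ} (hk : ∀ i < t, k i < k (i + 1)) {i : ℕ} (hi : i < t) :
    IsNext ((range (t + 1)).image k) (k i) (k (i + 1)) := by
  refine ⟨mem_image_of_mem _ (mem_range.2 (by omega)), Or.inl ⟨hk i hi, fun a ha => ?_⟩⟩
  obtain ⟨j, hj, rfl⟩ := mem_image.1 ha
  rw [mem_range] at hj
  rcases (show j < i ∨ j = i ∨ j = i + 1 ∨ i + 1 < j by omega) with h | rfl | rfl | h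
  · exact Or.inl (lt_of_chain hk h (by omega)).le
  · exact Or.inl le_rfl
  · exact Or.inr le_rfl
  · exact Or.inr (lt_of_chain hk h (by omega)).le

theorem isNext_chain_last {t : ℕ} {k : ℕ → ℕ} (hk : ∀ i < t, k i < k (i + 1)) :
    IsNext ((range (t + 1)).image k) (k t) (k 0) := by
  refine ⟨mem_image_of_mem _ (mem_range.2 (by omega)), Or.inr fun a ha => ?_⟩
  obtain ⟨j, hj, rfl⟩ := mem_image.1 ha
  rw [mem_range] at hj
  constructor
  · rcases Nat.eq_zero_or_pos j with rfl | h
    · exact le_rfl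
    · exact (lt_of_chain hk h (by omega)).le
  · rcases (show j = t ∨ j < t by omega) with rfl | h
    · exact le_rfl
    · exact (lt_of_chain hk h le_rfl).le

/-- The pairs prescribe the cyclic successor of every `k i`, and a block is a single cycle of its
successor map. -/
theorem chain_mem_iff {p q t : ℕ} {k : ℕ → ℕ} (hk : ∀ i < t, k i < k (i + 1))
    {P : Finset (Finset ℕ)} (hP : IsNCPart (Ico p q) P) :
    ((∀ i < t, {2 * k i + 1, 2 * k (i + 1)} ∈ fatten P) ∧ {2 * k t + 1, 2 * k 0} ∈ fatten P) ↔
      (range (t + 1)).image k ∈ P := by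
  simp only [pair_mem_fatten]
  constructor
  · rintro ⟨h1, U, hU, htU, hnext⟩
    have hmem : ∀ i ≤ t, k i ∈ U := by
      intro i
      induction i with
      | zero => exact fun _ => hnext.1
      | succ i ih =>
        intro hi
        obtain ⟨W, hW, hiW, hn⟩ := h1 i (by omega)
        rw [hP.eq_of_mem U hU W hW (k i) (ih (by omega)) hiW]
        exact hn.1
    have hall : ∀ x ∈ U, ∃ i ≤ t, k i = x := by
      refine IsNext.induction (S := fun x => ∃ i ≤ t, k i = x) htU ⟨t, le_rfl, rfl⟩ ?_
      rintro a c ha ⟨i, hi, rfl⟩ hac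
      rcases hi.eq_or_lt with rfl | hi
      · exact ⟨0, by omega, hnext.unique hac⟩
      · obtain ⟨W, hW, hiW, hn⟩ := h1 i hi
        obtain rfl := hP.eq_of_mem U hU W hW (k i) ha hiW
        exact ⟨i + 1, by omega, hn.unique hac⟩
    have e : (range (t + 1)).image k = U := by
      ext x
      rw [mem_image]
      constructor
      · rintro ⟨i, hi, rfl⟩
        rw [mem_range] at hi
        exact hmem i (by omega)
      · intro hx
        obtain ⟨i, hi, rfl⟩ := hall x hx
        exact ⟨i, by rw [mem_range]; omega, rfl⟩
    rwa [e]
  · intro h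
    exact ⟨fun i hi => ⟨_, h, mem_image_of_mem _ (mem_range.2 (by omega)), isNext_chain hk hi⟩,
      _, h, mem_image_of_mem _ (mem_range.2 (by omega)), isNext_chain_last hk⟩

theorem ncSumBlock_chain (f g : Finset ℕ → ℂ) {q : ℕ} (t : ℕ) (k : ℕ → ℕ)
    (hk : ∀ i < t, k i < k (i + 1)) (hq : k t < q) :
    ncSumBlock f g ((range (t + 1)).image k) (k 0) q =
      (∏ i ∈ range t, ncSumBlock f g {k i} (k i) (k (i + 1))) *
        ncSumBlock f g {k t} (k t) q := by
  induction t generalizing k with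
  | zero => simp
  | succ t ih =>
    have hk' : ∀ i < t, k (i + 1) < k (i + 1 + 1) := fun i hi => hk (i + 1) (by omega)
    have e : (range (t + 1 + 1)).image k =
        insert (k 0) ((range (t + 1)).image fun i => k (i + 1)) := by
      rw [range_add_one', image_insert, map_eq_image, image_image]
      rfl
    rw [e, ncSumBlock_insert (k := k 1) f g (hk 0 (by omega)),
      ih (fun i => k (i + 1)) hk' hq, prod_range_succ']
    · ring
    · intro x hx
      obtain ⟨i, hi, rfl⟩ := mem_image.1 hx
      rw [mem_range] at hi
      rw [mem_Ico]
      constructor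
      · rcases Nat.eq_zero_or_pos i with rfl | h
        · exact le_rfl
        · exact (lt_of_chain hk (i := 1) (j := i + 1) (by omega) (by omega)).le
      · rcases (show i = t ∨ i < t by omega) with rfl | h
        · exact hq
        · exact (lt_of_chain hk (j := t + 1) (by omega) le_rfl).trans hq
    · exact mem_image.2 ⟨0, by simp, rfl⟩

theorem letters_chain {B : Type*} (b : ℕ → B) {t : ℕ} {k : ℕ → ℕ} (hk : ∀ i < t, k i < k (i + 1)) :
    letters b ((range (t + 1)).image k) = (List.range (t + 1)).map fun i => b (k i) := by
  rw [letters, sort_eq_of_pairwise (l := (List.range (t + 1)).map k)]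
  · simp [Function.comp_def]
  · rw [List.pairwise_map]
    refine List.pairwise_lt_range.imp_of_mem fun ha hb hab => ?_
    rw [List.mem_range] at hb
    exact lt_of_chain hk hab (by omega)
  · simp

end Chain

/-- The same word read with `b` and `d` exchanged. The last letter `r m` is left arbitrary, since in
the application it wraps around to `b 1`. -/
theorem word_rotate (s : A) (b d r : ℕ → A) {m : ℕ} (hm : 1 ≤ m)
    (hr : ∀ i, 1 ≤ i → i < m → r i = b (i + 1)) :
    d 1 * (s * word s d r 1 m) = word s b d 1 m * s * r m := by
  induction m, hm using Nat.le_induction with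
  | base => simp [word_self, mul_assoc]
  | succ m hm ih =>
    rw [word_succ _ _ _ hm, word_succ _ _ _ hm, ← mul_assoc s, ← mul_assoc (d 1),
      ih fun i hi him => hr i hi (by omega), hr m hm (by omega)]
    simp only [mul_assoc]

variable [Algebra ℂ A] {φ : A →ₗ[ℂ] ℂ}

theorem sum_NC_partMoment (φ : A →ₗ[ℂ] ℂ) {n : ℕ} {x y : ℕ → A} {a c : Fin n → A}
    (ha : ∀ i, a i = x (1 + i)) (hc : ∀ i, c i = y (1 + i)) :
    ∑ π ∈ NC n, partMoment φ π a * partMoment φ (kreweras π) c =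
      ncSum (mom φ x) (mom φ y) 1 (n + 1) := by
  have h := sum_NC 1 (fun _ => True) (NC n) (by simp)
    (fun P => (∏ U ∈ P, mom φ x U) * ∏ W ∈ kr 1 (1 + n) P, mom φ y W)
  rw [filter_true] at h
  rw [ncSum, Nat.add_comm n 1, ← h]
  refine sum_congr rfl fun π _ => ?_
  rw [partMoment_eq φ ha, partMoment_eq φ hc, toNat_kreweras]

theorem card_toNat {n : ℕ} (p : ℕ) (π : Part n) :
    (∀ X ∈ toNat p π, X.card = 2) ↔ ∀ V ∈ π.parts, V.card = 2 := by
  simp [toNat]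

theorem mem_NC₂ {m : ℕ} {π : Part m} :
    π ∈ NC₂ m ↔ π ∈ NC m ∧ ∀ V ∈ π.parts, V.card = 2 := by
  simp [NC₂]

theorem sum_NC₂_partMoment (φ : A →ₗ[ℂ] ℂ) {n : ℕ} (b d : ℕ → A) (C : Finset (Finset ℕ) → Prop)
    [DecidablePred C] (S : Finset (Part (2 * n)))
    (hS : ∀ π, π ∈ S ↔ π ∈ NC₂ (2 * n) ∧ C (toNat 2 π)) :
    ∑ π ∈ S, partMoment φ (kreweras π) (altTuple n b d) =
      ∑ P ∈ ncp 1 (n + 1) with C (fatten P),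
        (∏ U ∈ P, mom φ b U) * ∏ W ∈ kr 1 (n + 1) P, mom φ d W := by
  classical
  -- With offset 2, the slots after `2 i` and `2 i + 1` carry `b i` and `d i`.
  set x : ℕ → A := fun m => if m % 2 = 0 then b (m / 2) else d (m / 2) with hx
  have ha : ∀ i : Fin (2 * n), altTuple n b d i = x (2 + i) := by
    intro i
    simp only [altTuple, hx]
    rw [show (2 + (i : ℕ)) % 2 = i % 2 by omega, show (2 + (i : ℕ)) / 2 = i / 2 + 1 by omega]
  have h := sum_NC 2 (fun R => (∀ X ∈ R, X.card = 2) ∧ C R) S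
    (fun π => by rw [hS, mem_NC₂, card_toNat, and_assoc])
    (fun R => ∏ W ∈ kr 2 (2 + 2 * n) R, mom φ x W)
  rw [show 2 + 2 * n = 2 * (n + 1) by ring] at h
  have hleft : ∑ π ∈ S, partMoment φ (kreweras π) (altTuple n b d) =
      ∑ π ∈ S, ∏ W ∈ kr 2 (2 * (n + 1)) (toNat 2 π), mom φ x W :=
    sum_congr rfl fun π _ => by
      rw [partMoment_eq φ ha, toNat_kreweras, show 2 + 2 * n = 2 * (n + 1) by ring]
  rw [hleft, h]
  have h' := sum_pairings 1 (n + 1) C (fun R => ∏ W ∈ kr (2 * 1) (2 * (n + 1)) R, mom φ x W)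
  rw [mul_one] at h'
  rw [h']
  refine sum_congr rfl fun P hP => ?_
  have hP := mem_ncp.1 (mem_filter.1 hP).1
  have h'' := prod_kr_fatten hP (mom φ x)
  rw [mul_one] at h''
  rw [h'']
  congr 1
  · refine prod_congr rfl fun U _ => ?_
    rw [mom, mom, letters_image _ (fun i j h => by simpa using h)]
    congr 3
    funext i
    simp [hx]
  · refine prod_congr rfl fun U _ => ?_
    rw [mom, mom, letters_image _ (fun i j h => by simpa using h)]
    congr 3
    funext i
    simp only [hx]
    rw [if_neg (by omega), show (2 * i + 1) / 2 = i by omega]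

/-- The label `a` is the element `a - 1` of `Fin m`, which the offset 2 sends to `a + 1`. -/
theorem hasPair_iff {m : ℕ} {π : Part m} {a c : ℕ} :
    HasPair π a c ↔ {a + 1, c + 1} ∈ toNat 2 π := by
  have key : ∀ V : Finset (Fin m),
      V.map (shiftEmb 2 m) = (V.image fun x : Fin m => (x : ℕ) + 1).image (· + 1) := by
    intro V
    ext x
    simp only [mem_map_shiftEmb, mem_image, exists_exists_and_eq_and]
    exact exists_congr fun i => and_congr_right fun _ => by omega
  have h : ({a + 1, c + 1} : Finset ℕ) = ({a, c} : Finset ℕ).image (· + 1) := by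
    simp [image_insert]
  rw [mem_toNat, HasPair, h]
  refine exists_congr fun V => and_congr_right fun _ => ?_
  rw [key]
  exact ((image_injective (add_left_injective 1)).eq_iff).symm

theorem mem_chainPairings {n t : ℕ} {k : ℕ → ℕ} (hk0 : k 0 = 1)
    (hk : ∀ i < t, k i < k (i + 1)) (π : Part (2 * n)) :
    π ∈ chainPairings n t k ↔ π ∈ NC₂ (2 * n) ∧
      ((∀ i < t, {2 * k i + 1, 2 * k (i + 1)} ∈ toNat 2 π) ∧
        {2 * k t + 1, 2 * k 0} ∈ toNat 2 π) := by
  simp only [chainPairings, mem_filter, hasPair_iff]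
  refine and_congr_right fun _ => and_congr (forall₂_congr fun i hi => ?_) ?_
  · have := hk i hi
    rw [show 2 * k (i + 1) - 1 + 1 = 2 * k (i + 1) by omega]
  · rw [show 2 * k 0 - 1 + 1 = 2 * k 0 by omega]

theorem word_closeUp (hφ : ∀ x y : A, φ (x * y) = φ (y * x)) (s : A) (b d : ℕ → A) {n : ℕ}
    (hn : 1 ≤ n) :
    φ (word s b d 0 n) = φ (b 1 * (s * word s b (closeUp n d) 1 n * s)) := by
  rw [closeUp, word_update_last _ _ _ _ hn, word_eq_cons _ _ _ hn, hφ (d 0)]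
  have e : s * b (0 + 1) * s * word s b d (0 + 1) n * d 0 =
      s * (b 1 * s * word s b d 1 n * d 0) := by simp only [mul_assoc, zero_add]
  rw [e, hφ s]
  simp only [mul_assoc]

theorem sum_chain_block (f g : Finset ℕ → ℂ) (V : Finset ℕ) (p q : ℕ) :
    ∑ P ∈ ncp p q with V ∈ P, (∏ U ∈ P, f U) * ∏ W ∈ kr p q P, g W =
      f V * ncSumBlock f g V p q := by
  rw [ncSumBlock, mul_sum]
  refine sum_congr rfl fun P hP => ?_
  rw [← mul_assoc, mul_prod_erase _ _ (mem_filter.1 hP).2]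

end FreeMoments

end

open FreeMoments in
theorem lemma5p1 {A : Type*} [Ring A] [Algebra ℂ A] (φ : A →ₗ[ℂ] ℂ) (hφ_one : φ 1 = 1)
    (hφ_trace : ∀ x y : A, φ (x * y) = φ (y * x))
    (n : ℕ) (hn : 1 ≤ n) (s : A) (b d : ℕ → A) (hs : IsSemicircular φ s)
    (hfree : AreFree φ ![{s}, b '' Set.Icc 1 n, d '' Set.Icc 0 n]) :
    (φ (word s b d 0 n) =
        ∑ π ∈ NC₂ (2 * n), partMoment φ (kreweras π) (altTuple n b (closeUp n d)) ∧
      φ (word s b d 0 n) =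
        ∑ π ∈ NC n, partMoment φ π (tuple n b) *
          partMoment φ (kreweras π) (tuple n (closeUp n d)) ∧
      φ (word s b d 0 n) =
        ∑ π ∈ NC n, partMoment φ π (tuple n (closeUp n d)) *
          partMoment φ (kreweras π) (rotTuple n b)) ∧
    ∀ (t : ℕ) (k : ℕ → ℕ), k 0 = 1 → (∀ i < t, k i < k (i + 1)) → k t ≤ n →
      ∑ π ∈ chainPairings n t k, partMoment φ (kreweras π) (altTuple n b (closeUp n d)) =
        φ ((List.range (t + 1)).map fun i => b (k i)).prod *
          ((∏ i ∈ Finset.range t, φ (word s b d (k i) (k (i + 1) - 1))) *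
            φ (word s b (closeUp n d) (k t) n)) := by
  classical
  have hS := semicircularOver_closure hfree hφ_one hs (c₀ := 0) rfl
  set M := Submonoid.closure
    {y | ∃ c, c ≠ 0 ∧ y ∈ ![{s}, b '' Set.Icc 1 n, d '' Set.Icc 0 n] c}
  have hb : ∀ i, 1 ≤ i → i ≤ n → b i ∈ M := fun i h1 h2 =>
    Submonoid.subset_closure ⟨1, by decide, i, ⟨h1, h2⟩, rfl⟩
  have hd : ∀ i, i ≤ n → d i ∈ M := fun i h =>
    Submonoid.subset_closure ⟨2, by decide, i, ⟨i.zero_le, h⟩, rfl⟩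
  have hD : ∀ i, 1 ≤ i → i ≤ n → closeUp n d i ∈ M := by
    intro i _ h
    rw [closeUp, Function.update_apply]
    split_ifs
    · exact M.mul_mem (hd n le_rfl) (hd 0 n.zero_le)
    · exact hd i h
  have hsum := (ncSum_eq_word hS hφ_trace hn hb hD).trans (word_closeUp hφ_trace s b d hn).symm
  refine ⟨⟨?_, ?_, ?_⟩, ?_⟩
  · rw [sum_NC₂_partMoment φ b (closeUp n d) (fun _ => True) _ (by simp), ← hsum, ncSum,
      Finset.filter_true]
  · rw [sum_NC_partMoment φ (x := b) (y := closeUp n d), hsum]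
    · intro i
      rw [tuple, Nat.add_comm]
    · intro i
      rw [tuple, Nat.add_comm]
  -- Now the blocks carry the `d i` and the slots the shifted `b`; the reduction modulo `n` gives
  -- slot `n` the letter `b 1`.
  · rw [sum_NC_partMoment φ (x := closeUp n d) (y := fun i => b (i % n + 1)),
      ncSum_eq_word hS hφ_trace hn hD, word_closeUp hφ_trace s b d hn]
    · rw [hφ_trace (b 1), ← mul_assoc (closeUp n d 1), word_rotate s b (closeUp n d) _ hn]
      · rw [Nat.mod_self, zero_add, hφ_trace _ s]
        simp only [mul_assoc]
      · intro i _ hi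
        rw [Nat.mod_eq_of_lt hi]
    · intro i _ _
      exact hb _ (by omega) (by have := Nat.mod_lt i hn; omega)
    · intro i
      rw [tuple, Nat.add_comm]
    · intro i
      rw [rotTuple, Nat.add_comm 1]
  · intro t k hk0 hk hkt
    have hpos : ∀ i ≤ t, 1 ≤ k i := by
      intro i hi
      rcases Nat.eq_zero_or_pos i with rfl | h
      · omega
      · have := lt_of_chain hk h hi
        omega
    have hle : ∀ i ≤ t, k i ≤ n := by
      intro i hi
      rcases hi.eq_or_lt with rfl | h
      · exact hkt
      · have := lt_of_chain hk h le_rfl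
        omega
    rw [sum_NC₂_partMoment φ b (closeUp n d)
      (fun R => (∀ i < t, {2 * k i + 1, 2 * k (i + 1)} ∈ R) ∧ {2 * k t + 1, 2 * k 0} ∈ R) _
      (mem_chainPairings hk0 hk),
      Finset.filter_congr fun P hP => chain_mem_iff hk (mem_ncp.1 hP), sum_chain_block, mom,
      letters_chain b hk]
    congr 1
    have h := ncSumBlock_chain (mom φ b) (mom φ (closeUp n d)) t k hk (Nat.lt_succ_of_le hkt)
    rw [hk0] at h
    rw [h]
    congr 1
    · refine Finset.prod_congr rfl fun i hi => ?_
      rw [Finset.mem_range] at hi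
      have h1 := hk i hi
      have h2 := hpos i hi.le
      have h3 := hle (i + 1) hi
      have hw := ncSumBlock_eq_word hS hφ_trace (b := b) (d := closeUp n d) (p := k i)
        (l := k (i + 1) - 1) (by omega) (fun j hj hj' => hb j (by omega) (by omega))
        (fun j hj hj' => hD j (by omega) (by omega))
      rw [show k (i + 1) - 1 + 1 = k (i + 1) by omega] at hw
      rw [hw, word_congr (b' := b) (d' := d) (by omega) (fun _ _ _ => rfl)]
      -- `closeUp` alters only the index `n`, and this gap ends at `k (i + 1) - 1 < n`.
      intro j _ hj
      rw [closeUp, Function.update_of_ne (by omega)]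
    · have h2 := hpos t le_rfl
      exact ncSumBlock_eq_word hS hφ_trace hkt (fun j hj hj' => hb j (by omega) hj')
        (fun j hj hj' => hD j (by omega) hj')
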